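/- Let $\delta>0$ and let $\beta:\mathbb R\to\mathbb R$ be smooth with $\beta_0\le\beta(t)\le\beta_1$ for all $t$, where $0<\beta_0\le\beta_1$ are constants. Let $P$ be the two-sided Wiener measure on $\Omega=\{\omega\in C(\mathbb R,\mathbb R):\omega(0)=0\}$ with the Borel $\sigma$-algebra of the compact-open topology, let $\theta_t\omega(s)=\omega(s+t)-\omega(t)$, and let $\tilde\Omega$ be the $\theta$-invariant set of those $\omega\in\Omega$ for which $$\lim_{t\to\pm\infty}\frac{\omega(t)}{t}=0,\qquad \int_{-\infty}^0e^{\delta\omega(s)}\,ds=\int_0^\infty e^{\delta\omega(s)}\,ds=\infty .$$ For $\lambda\in\mathbb R$ consider the Stratonovich equation $$dx=(\lambda x-\beta(t)x^2)\,dt+\delta x\circ d\omega,\qquad x(\tau)=x_0,\quad t\ge\tau, \tag{1}$$ and set $$x(t,\tau,\omega,x_0)=\frac{x_0}{d(t)},\qquad d(t)=e^{\lambda(\tau-t)+\delta(\omega(\tau)-\omega(t))}+x_0\int_\tau^te^{\lambda(r-t)+\delta(\omega(r)-\omega(t))}\beta(r)\,dr ,$$ this being defined at time $t\ge\tau$ when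 $d(t)>0$. Let $\Phi(t,\tau,\omega,x_0)=x(t+\tau,\tau,\theta_{-\tau}\omega,x_0)$, for $t\ge0$, be the corresponding (local) cocycle, with $\omega\in\tilde\Omega$. For $\tau\in\mathbb R$ and $\omega\in\tilde\Omega$ put $$x_\lambda(\tau,\omega)=\Big(\int_{-\infty}^0e^{\lambda r+\delta\omega(r)}\beta(r+\tau)\,dr\Big)^{-1}\ (\lambda>0),\qquad x_\lambda(\tau,\omega)=-\Big(\int_0^{\infty}e^{\lambda r+\delta\omega(r)}\beta(r+\tau)\,dr\Big)^{-1}\ (\lambda<0).$$ A function $f:\mathbb R\to\mathbb R$ is *almost periodic* if for every $\varepsilon>0$ there is $l>0$ such that every interval of length $l$ contains some $t_0$ with $|f(\tau+t_0)-f(\tau)|<\varepsilon$ for all $\tau$. It is *almost automorphic* if every real sequence has a subsequence $(\tau_m)$ for which there is $\zeta:\mathbb R\to\mathbb R$ with $f(\tau+\tau_m)\to\zeta(\tau)$ and $\zeta(\tau-\tau_m)\to f(\tau)$ for every $\tau$. A *random periodic (almost periodic, almost automorphic) solution* is a map $\xi:\mathbb R\times\tilde\Omega\to\mathbb R$, measurable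 in $\omega$, such that $\Phi(t,\tau,\omega,\xi(\tau,\omega))$ is defined and equals $\xi(\tau+t,\theta_t\omega)$ for all $t\ge0$, $\tau$, $\omega$, and such that $\xi(\cdot,\omega)$ is periodic with a period not depending on $\omega$ (almost periodic, almost automorphic) for every $\omega$. The fixed point $0$ is *pullback Lyapunov stable* in $(0,\infty)$ if for all $\tau$, $\omega$ and $\varepsilon>0$ there is $\eta>0$ such that $\Phi(t,\tau-t,\theta_{-t}\omega,(0,\eta))\subseteq(0,\varepsilon)$ for all $t\ge0$; otherwise it is *unstable* there. It is *pullback asymptotically stable* in $(0,\infty)$ if in addition $\Phi(t,\tau-t,\theta_{-t}\omega,x)\to0$ as $t\to\infty$ for all $\tau$, $\omega$ and $x>0$. Suppose that $\beta$ is periodic with period $T>0$ (respectively almost periodic, almost automorphic). Then $P(\tilde\Omega)=1$, and for all $\lambda,\tau,x_0\in\mathbb R$ the process $x(\cdot,\tau,\cdot,x_0)$ is a maximal adapted solution of (1) in the sense of Stratonovich integration, exploding at the end of its lifetime when this is finite. Moreover: (i) If $\lambda<0$, then $0$ and $x_\lambda$ are random periodic with period $T$ (respectively almost periodic, almost automorphic)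 solutions, and $x_\lambda(\tau,\omega)<0$ for all $\tau,\omega$. The zero solution is pullback asymptotically stable in $(0,\infty)$, and for every compact $K\subset(0,\infty)$ and all $\tau,\omega$, $$\lim_{t\to\infty}\ \sup_{x_0\in K}|\Phi(t,\tau-t,\theta_{-t}\omega,x_0)|=0 .$$ Furthermore $\lim_{\lambda\to0^-}x_\lambda(\tau,\omega)=0$ for all $\tau,\omega$. (ii) If $\lambda>0$, then $0$ and $x_\lambda$ are random periodic with period $T$ (respectively almost periodic, almost automorphic) solutions, and $x_\lambda(\tau,\omega)>0$ for all $\tau,\omega$. The zero solution is unstable in $(0,\infty)$, and for every compact $K\subset(0,\infty)$ and all $\tau,\omega$, $$\lim_{t\to\infty}\ \sup_{x_0\in K}|\Phi(t,\tau-t,\theta_{-t}\omega,x_0)-x_\lambda(\tau,\omega)|=0 .$$ Furthermore $\lim_{\lambda\to0^+}x_\lambda(\tau,\omega)=0$ for all $\tau,\omega$. -/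

import Mathlib

open MeasureTheory ProbabilityTheory Filter Topology Set
open scoped ENNReal

noncomputable section

/-! ## Two-sided Wiener space -/

/-- The space `Ω` of continuous `ω : ℝ → ℝ` with `ω 0 = 0`. -/
def WienerPath : Type := {ω : C(ℝ, ℝ) // ω 0 = 0}

namespace WienerPath

instance : CoeFun WienerPath (fun _ => ℝ → ℝ) := ⟨fun ω => ω.1⟩

/-- The compact-open topology. -/
instance : TopologicalSpace WienerPath := instTopologicalSpaceSubtype

/-- The Borel `σ`-algebra of the compact-open topology. -/
instance : MeasurableSpace WienerPath := borel WienerPath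

instance : BorelSpace WienerPath := ⟨rfl⟩

theorem map_zero (ω : WienerPath) : ω 0 = 0 := ω.2

theorem continuous (ω : WienerPath) : Continuous ω := ω.1.continuous

/-- The Wiener shift `(θ_t ω)(s) = ω(s + t) - ω(t)`. -/
def shift (t : ℝ) (ω : WienerPath) : WienerPath :=
  ⟨⟨fun s => ω (s + t) - ω t,
    (ω.continuous.comp (continuous_id.add continuous_const)).sub continuous_const⟩, by simp⟩

@[simp] theorem shift_apply (t : ℝ) (ω : WienerPath) (s : ℝ) :
    shift t ω s = ω (s + t) - ω t := rfl

end WienerPath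

/-- `P` is the (two-sided) Wiener measure: under `P`, the coordinate process has independent
increments, and `ω(t) - ω(s)` is centred Gaussian with variance `t - s` for `s ≤ t`. -/
structure IsWienerMeasure (P : Measure WienerPath) : Prop where
  isProbabilityMeasure : IsProbabilityMeasure P
  hasIndepIncrements : HasIndepIncrements (fun (t : ℝ) (ω : WienerPath) => ω t) P
  hasLaw_sub : ∀ s t : ℝ, s ≤ t →
    HasLaw (fun ω : WienerPath => ω t - ω s) (gaussianReal 0 (t - s).toNNReal) P

/-- The paths with sublinear growth in both time directions for which both exponential functionals
diverge. -/
structure IsRegularPath (δ : ℝ) (ω : WienerPath) : Prop where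
  sublinear_atTop : Tendsto (fun t : ℝ => ω t / t) atTop (𝓝 0)
  sublinear_atBot : Tendsto (fun t : ℝ => ω t / t) atBot (𝓝 0)
  lintegral_past : ∫⁻ s in Iic (0 : ℝ), ENNReal.ofReal (Real.exp (δ * ω s)) = ∞
  lintegral_future : ∫⁻ s in Ici (0 : ℝ), ENNReal.ofReal (Real.exp (δ * ω s)) = ∞

/-- The restricted path space `Ω̃`. -/
abbrev RegularPath (δ : ℝ) : Type := {ω : WienerPath // IsRegularPath δ ω}

theorem lintegral_exp_shift_eq_top {δ : ℝ} (ω : WienerPath) (t : ℝ) {A : Set ℝ}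
    (h : ∫⁻ s in A, ENNReal.ofReal (Real.exp (δ * ω s)) = ∞)
    {B : Set ℝ} {a b : ℝ} (hAB : A ⊆ ((fun s => s - t) ⁻¹' B) ∪ Icc a b) :
    ∫⁻ s in B, ENNReal.ofReal (Real.exp (δ * WienerPath.shift t ω s)) = ∞ := by
  have hc : Continuous fun s : ℝ => Real.exp (δ * ω s) :=
    Real.continuous_exp.comp (continuous_const.mul ω.continuous)
  have hfin : ∫⁻ s in Icc a b, ENNReal.ofReal (Real.exp (δ * ω s)) ≠ ∞ := by
    have := (hc.continuousOn (s := Icc a b)).integrableOn_compact isCompact_Icc (μ := volume)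
    exact (this.lintegral_lt_top).ne
  have hle := (lintegral_mono_set (μ := volume)
    (f := fun s => ENNReal.ofReal (Real.exp (δ * ω s))) hAB).trans
    (lintegral_union_le _ _ _)
  rw [h, top_le_iff, ENNReal.add_eq_top] at hle
  have h1 := hle.resolve_right hfin
  have hmp : MeasurePreserving (fun s : ℝ => s - t) volume volume := measurePreserving_sub_right _ t
  have hemb : MeasurableEmbedding (fun s : ℝ => s - t) :=
    (MeasurableEquiv.subRight t).measurableEmbedding
  rw [← hmp.setLIntegral_comp_preimage_emb hemb]
  have h2 : ∀ s, ENNReal.ofReal (Real.exp (δ * WienerPath.shift t ω (s - t)))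
      = ENNReal.ofReal (Real.exp (-(δ * ω t))) * ENNReal.ofReal (Real.exp (δ * ω s)) := by
    intro s
    rw [← ENNReal.ofReal_mul (Real.exp_pos _).le, ← Real.exp_add]
    simp only [WienerPath.shift_apply, sub_add_cancel]
    congr 2
    ring
  simp only [h2]
  rw [lintegral_const_mul' _ _ ENNReal.ofReal_ne_top, h1]
  exact ENNReal.mul_top (by simp [Real.exp_pos])

theorem tendsto_shift_div {l : Filter ℝ} (ω : WienerPath) (t : ℝ)
    (hl : Tendsto (fun s : ℝ => s + t) l l) (hne : ∀ᶠ s : ℝ in l, s ≠ 0 ∧ s + t ≠ 0)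
    (hinv : Tendsto (fun s : ℝ => s⁻¹) l (𝓝 0))
    (h : Tendsto (fun s : ℝ => ω s / s) l (𝓝 0)) :
    Tendsto (fun s : ℝ => WienerPath.shift t ω s / s) l (𝓝 0) := by
  have h1 : Tendsto (fun s : ℝ => ω (s + t) / (s + t) * (1 + t * s⁻¹) - ω t * s⁻¹) l
      (𝓝 (0 * (1 + t * 0) - ω t * 0)) :=
    ((h.comp hl).mul (tendsto_const_nhds.add (tendsto_const_nhds.mul hinv))).sub
      (tendsto_const_nhds.mul hinv)
  simp only [mul_zero, add_zero, zero_mul, sub_zero] at h1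
  refine h1.congr' ?_
  filter_upwards [hne] with s hs
  obtain ⟨hs1, hs2⟩ := hs
  simp only [WienerPath.shift_apply]
  field_simp

/-- `Ω̃` is invariant under the Wiener shift. -/
theorem IsRegularPath.shift {δ : ℝ} {ω : WienerPath} (h : IsRegularPath δ ω) (t : ℝ) :
    IsRegularPath δ (WienerPath.shift t ω) where
  sublinear_atTop := tendsto_shift_div ω t (tendsto_atTop_add_const_right _ t tendsto_id)
    ((eventually_ne_atTop 0).and
      ((tendsto_atTop_add_const_right _ t tendsto_id).eventually (eventually_ne_atTop 0)))
    tendsto_inv_atTop_zero h.sublinear_atTop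
  sublinear_atBot := tendsto_shift_div ω t (tendsto_atBot_add_const_right _ t tendsto_id)
    ((eventually_ne_atBot 0).and
      ((tendsto_atBot_add_const_right _ t tendsto_id).eventually (eventually_ne_atBot 0)))
    tendsto_inv_atBot_zero h.sublinear_atBot
  lintegral_past := lintegral_exp_shift_eq_top ω t h.lintegral_past
    (a := t) (b := 0) (by
      intro s hs
      rcases le_total s t with h' | h'
      · left; simpa using h'
      · right; exact ⟨h', hs⟩)
  lintegral_future := lintegral_exp_shift_eq_top ω t h.lintegral_future
    (a := 0) (b := t) (by
      intro s hs
      rcases le_total t s with h' | h'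
      · left; simpa using h'
      · right; exact ⟨hs, h'⟩)

/-- The group `θ` acting on `Ω̃`. -/
def RegularPath.shift {δ : ℝ} (t : ℝ) (ω : RegularPath δ) : RegularPath δ :=
  ⟨WienerPath.shift t ω.1, ω.2.shift t⟩

/-! ## Stratonovich equations -/

/-- `J` is the Stratonovich integral `∫_a^b X ∘ dW` under `μ`: the limit in probability of the
trapezoidal sums along every sequence of finite partitions of `[a, b]` with mesh tending to `0`.
The `n`-th partition consists of `s n 0 ≤ s n 1 ≤ ... ≤ s n (N n)`. -/
def IsStratonovichIntegral {Ω : Type*} [MeasurableSpace Ω] (μ : Measure Ω)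
    (X W : ℝ → Ω → ℝ) (a b : ℝ) (J : Ω → ℝ) : Prop :=
  ∀ (N : ℕ → ℕ) (s : ℕ → ℕ → ℝ),
    (∀ n, Monotone (s n) ∧ s n 0 = a ∧ s n (N n) = b) →
    (∀ η > 0, ∀ᶠ n in atTop, ∀ i < N n, s n (i + 1) - s n i < η) →
    TendstoInMeasure μ
      (fun n ω => ∑ i ∈ Finset.range (N n),
        (X (s n i) ω + X (s n (i + 1)) ω) / 2 * (W (s n (i + 1)) ω - W (s n i) ω))
      atTop J

/-- The `σ`-algebra generated by the increments of the path on `[τ, t]`. -/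
abbrev incrementSigma (τ t : ℝ) : MeasurableSpace WienerPath :=
  ⨆ s ∈ Icc τ t, MeasurableSpace.comap (fun ω : WienerPath => ω s - ω τ) (borel ℝ)

/-- `X`, started at `x₀` at time `τ`, is a maximal (local) adapted solution of
`dx = f(t,x) dt + g(t,x) ∘ dω`.  The event that the solution has not exploded up to time `t`
is `alive t`; the values of `X t` off `alive t` are irrelevant. -/
structure IsMaximalStratonovichSolution (P : Measure WienerPath) (f g : ℝ → ℝ → ℝ) (τ x₀ : ℝ)
    (alive : ℝ → Set WienerPath) (X : ℝ → WienerPath → ℝ) : Prop where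
  alive_initial : alive τ = univ
  alive_antitone : ∀ s t, τ ≤ s → s ≤ t → alive t ⊆ alive s
  alive_open : ∀ t, τ ≤ t → ∀ ω ∈ alive t, ∃ t' > t, ω ∈ alive t'
  explosion : ∀ ω, ∀ t > τ, (∀ s, τ ≤ s → s < t → ω ∈ alive s) → ω ∉ alive t →
    Tendsto (fun s => |X s ω|) (𝓝[<] t) atTop
  initial : ∀ ω, X τ ω = x₀
  continuousOn : ∀ t, τ ≤ t → ∀ ω ∈ alive t, ContinuousOn (fun s => X s ω) (Icc τ t)
  adapted_alive : ∀ t, τ ≤ t → MeasurableSet[incrementSigma τ t] (alive t)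
  adapted : ∀ t, τ ≤ t → Measurable[incrementSigma τ t] (X t)
  equation : ∀ t, τ ≤ t →
    IsStratonovichIntegral (P.restrict (alive t)) (fun s ω => g s (X s ω)) (fun s ω => ω s) τ t
      (fun ω => X t ω - x₀ - ∫ s in τ..t, f s (X s ω))

/-! ## Random dynamical notions for a (local) cocycle

`Φ t τ ω x` is the state at time `τ + t` of the solution that starts from `x` at time `τ`; it is
undefined if that solution explodes. Only `t ≥ 0` is used. -/

section Cocycle

variable {Ω X : Type*} [PseudoMetricSpace X]

/-- `Φ(t, τ, ω, ξ(τ, ω)) = ξ(τ + t, θ_t ω)` for all `t ≥ 0`, `τ`, `ω`; in particular the left-hand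
side is defined. -/
def IsCompleteQuasiSolution (θ : ℝ → Ω → Ω) (Φ : ℝ → ℝ → Ω → X → Part X) (ξ : ℝ → Ω → X) : Prop :=
  ∀ t, 0 ≤ t → ∀ τ ω, ξ (τ + t) (θ t ω) ∈ Φ t τ ω (ξ τ ω)

def IsCocycleFixedPoint (Φ : ℝ → ℝ → Ω → X → Part X) (x₀ : X) : Prop :=
  ∀ t, 0 ≤ t → ∀ τ ω, x₀ ∈ Φ t τ ω x₀

/-- Pullback Lyapunov stability of `x₀` in `E`. -/
def IsPullbackLyapunovStable (θ : ℝ → Ω → Ω) (Φ : ℝ → ℝ → Ω → X → Part X) (x₀ : X) (E : Set X) :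
    Prop :=
  ∀ τ ω, ∀ ε > 0, ∃ η > 0, ∀ t, 0 ≤ t → ∀ x ∈ Metric.ball x₀ η ∩ E,
    ∃ y ∈ Φ t (τ - t) (θ (-t) ω) x, y ∈ Metric.ball x₀ ε ∩ E

/-- `ξ` pullback attracts `K`: the Hausdorff semi-distance from `Φ(t, τ - t, θ_{-t} ω, K)` to
`ξ(τ, ω)` tends to `0` as `t → ∞`. -/
def PullbackAttracts (θ : ℝ → Ω → Ω) (Φ : ℝ → ℝ → Ω → X → Part X) (ξ : ℝ → Ω → X) (K : Set X) :
    Prop :=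
  ∀ τ ω, ∀ ε > 0, ∀ᶠ t in atTop, ∀ x ∈ K,
    ∃ y ∈ Φ t (τ - t) (θ (-t) ω) x, dist y (ξ τ ω) < ε

/-- The fixed point `x₀` is pullback asymptotically stable in `E`. -/
structure IsPullbackAsymptoticallyStable (θ : ℝ → Ω → Ω) (Φ : ℝ → ℝ → Ω → X → Part X) (x₀ : X)
    (E : Set X) : Prop where
  isFixedPoint : IsCocycleFixedPoint Φ x₀
  stable : IsPullbackLyapunovStable θ Φ x₀ E
  attracts : ∀ x ∈ E, PullbackAttracts θ Φ (fun _ _ => x₀) {x}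

/-- The fixed point `x₀` is pullback Lyapunov unstable in `E`. -/
structure IsPullbackUnstable (θ : ℝ → Ω → Ω) (Φ : ℝ → ℝ → Ω → X → Part X) (x₀ : X)
    (E : Set X) : Prop where
  isFixedPoint : IsCocycleFixedPoint Φ x₀
  not_stable : ¬ IsPullbackLyapunovStable θ Φ x₀ E

end Cocycle

/-! ## Periodic, almost periodic and almost automorphic functions -/

/-- The three kinds of recurrence. -/
inductive Recurrence : Type
  /-- periodic with the given period -/
  | periodic (T : ℝ) (hT : 0 < T) : Recurrence
  /-- almost periodic -/
  | almostPeriodic : Recurrence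
  /-- almost automorphic -/
  | almostAutomorphic : Recurrence

/-- `f : ℝ → X` has the given kind of recurrence. -/
def Recurrence.Holds {X : Type*} [PseudoMetricSpace X] : Recurrence → (ℝ → X) → Prop
  | .periodic T _, f => ∀ τ, f (τ + T) = f τ
  | .almostPeriodic, f => ∀ ε > 0, ∃ l > 0, ∀ a : ℝ, ∃ t₀ ∈ Icc a (a + l),
      ∀ τ, dist (f (τ + t₀)) (f τ) < ε
  | .almostAutomorphic, f => ∀ u : ℕ → ℝ, ∃ φ : ℕ → ℕ, StrictMono φ ∧ ∃ ζ : ℝ → X, ∀ τ,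
      Tendsto (fun m => f (τ + u (φ m))) atTop (𝓝 (ζ τ)) ∧
      Tendsto (fun m => ζ (τ - u (φ m))) atTop (𝓝 (f τ))

/-- A random periodic (almost periodic, almost automorphic) solution of `Φ`: a measurable complete
quasi-solution `ξ` such that `ξ(·, ω)` is periodic (almost periodic, almost automorphic) for every
`ω`. -/
structure IsRandomRecurrentSolution {Ω X : Type*} [MeasurableSpace Ω] [PseudoMetricSpace X]
    [MeasurableSpace X] (k : Recurrence) (θ : ℝ → Ω → Ω) (Φ : ℝ → ℝ → Ω → X → Part X)
    (ξ : ℝ → Ω → X) : Prop where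
  measurable : ∀ τ, Measurable (ξ τ)
  isCompleteQuasiSolution : IsCompleteQuasiSolution θ Φ ξ
  recurrent : ∀ ω, k.Holds fun τ => ξ τ ω

/-! ## The equation `dx = (lam x - β(t) x²) dt + δ x ∘ dω` -/

namespace Transcritical

/-- The denominator of the solution formula; the solution from `x₀` at time `τ` is alive at time
`t ≥ τ` iff this is positive. -/
def denom (lam δ : ℝ) (β : ℝ → ℝ) (t τ : ℝ) (ω : WienerPath) (x₀ : ℝ) : ℝ :=
  Real.exp (lam * (τ - t) + δ * (ω τ - ω t)) +
    x₀ * ∫ r in τ..t, Real.exp (lam * (r - t) + δ * (ω r - ω t)) * β r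

/-- The solution `x(t, τ, ω, x₀)`. -/
def sol (lam δ : ℝ) (β : ℝ → ℝ) (t τ : ℝ) (ω : WienerPath) (x₀ : ℝ) : ℝ :=
  x₀ / denom lam δ β t τ ω x₀

/-- The event that `x(·, τ, ω, x₀)` exists up to time `t`. -/
def alive (lam δ : ℝ) (β : ℝ → ℝ) (τ x₀ t : ℝ) : Set WienerPath :=
  {ω | 0 < denom lam δ β t τ ω x₀}

/-- The local cocycle `Φ(t, τ, ω, x₀) = x(t + τ, τ, θ_{-τ} ω, x₀)` on `Ω̃`. -/
def cocycle (lam δ : ℝ) (β : ℝ → ℝ) (t τ : ℝ) (ω : RegularPath δ) (x₀ : ℝ) : Part ℝ :=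
  ⟨WienerPath.shift (-τ) ω.1 ∈ alive lam δ β τ x₀ (t + τ),
    fun _ => sol lam δ β (t + τ) τ (WienerPath.shift (-τ) ω.1) x₀⟩

/-- The random function `x_lam(τ, ω)` (the value at `lam = 0` is not used). -/
def xBif (lam δ : ℝ) (β : ℝ → ℝ) (τ : ℝ) (ω : RegularPath δ) : ℝ :=
  if 0 < lam then (∫ r in Iic (0 : ℝ), Real.exp (lam * r + δ * ω.1 r) * β (r + τ))⁻¹
  else -(∫ r in Ici (0 : ℝ), Real.exp (lam * r + δ * ω.1 r) * β (r + τ))⁻¹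

end Transcritical

end

/-! ## Exponential weights along paths of sublinear growth -/

section ExpWeight

/-! The equation is of Bernoulli type: `1 / x` solves a linear equation, so everything can be read
off one explicit quotient. Pulled back to the present, the state reached from `x` at time `τ - t` is
`x / (E t + x * J t)` with `E t = exp (-lam * t + δ * ω (-t))` and `J t` the integral of `exp (lam *
r + δ * ω r) * β (r + τ)` over `[-t, 0]` (`mem_cocycle_pullback`). As `ω` grows sublinearly, the
sign of `lam` decides. If `lam < 0`, then `E t` tends to infinity and everything positive is drawn
to `0`. If `lam > 0`, then `E t` tends to `0` and `J t` converges to the reciprocal of `xBif`, so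
every positive compact set is drawn to `xBif`, and `0` cannot be stable.

The reciprocal of `xBif`, up to sign, is an integral of translates of `β` against an integrable
positive weight. Each kind of recurrence survives such averaging (`Recurrence.Holds.setIntegral`),
and survives inversion because the average is bounded away from zero. Invariance of `xBif` follows
from a change of variables and additivity of the integral. As `lam` tends to `0`, Fatou's lemma and
the divergence of `∫ exp (δ * ω)` force the integral to infinity.

That almost every path is regular is proved for each half-line separately. A maximal inequality and
Borel–Cantelli give sublinear growth. Independent increments along very sparse times give infinitely
many unit intervals on which the path is nonnegative, whence the divergence.

For the Stratonovich equation, the solution is `A t * exp (δ * ω t)` with `A` continuously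
differentiable along each path while the solution is alive. The trapezoidal rule applied to the
exponential has a cubic error, so the total error is a small factor times the sum of squared
increments plus a small drift error. That sum has expectation equal to the length of the interval,
hence is bounded in probability, and the trapezoidal sums converge in probability without any appeal
to Itô calculus. -/

theorem eventually_linear_add_sublinear_le {g : ℝ → ℝ}
    (hlim : Tendsto (fun t => g t / t) atTop (𝓝 0)) {c : ℝ} (hc : c < 0) (δ : ℝ) :
    ∀ᶠ t in atTop, c * t + δ * g t ≤ c / 2 * t := by
  have h1 : Tendsto (fun t => δ * (g t / t)) atTop (𝓝 0) := by simpa using hlim.const_mul δ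
  filter_upwards [h1.eventually (gt_mem_nhds (show (0 : ℝ) < -c / 2 by linarith)),
    eventually_gt_atTop 0] with t ht ht0
  have h2 : δ * g t = δ * (g t / t) * t := by field_simp
  nlinarith

theorem tendsto_exp_linear_add_sublinear {g : ℝ → ℝ}
    (hlim : Tendsto (fun t => g t / t) atTop (𝓝 0)) {c : ℝ} (hc : c < 0) (δ : ℝ) :
    Tendsto (fun t => Real.exp (c * t + δ * g t)) atTop (𝓝 0) := by
  have h : Tendsto (fun t => Real.exp (c / 2 * t)) atTop (𝓝 0) :=
    Real.tendsto_exp_atBot.comp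
      ((tendsto_const_mul_atBot_of_neg (by linarith)).2 tendsto_id)
  refine squeeze_zero' (Eventually.of_forall fun _ => (Real.exp_pos _).le) ?_ h
  filter_upwards [eventually_linear_add_sublinear_le hlim hc δ] with t ht
  exact Real.exp_le_exp.2 ht

theorem integrableOn_exp_linear_add_sublinear {g : ℝ → ℝ} (hg : Continuous g)
    (hlim : Tendsto (fun t => g t / t) atTop (𝓝 0)) {c : ℝ} (hc : c < 0) (δ a : ℝ) :
    IntegrableOn (fun t => Real.exp (c * t + δ * g t)) (Ici a) := by
  rw [integrableOn_Ici_iff_integrableOn_Ioi]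
  refine integrable_of_isBigO_exp_neg (b := -c / 2) (by linarith)
    (by fun_prop) (Asymptotics.IsBigO.of_bound 1 ?_)
  filter_upwards [eventually_linear_add_sublinear_le hlim hc δ] with t ht
  rw [one_mul, Real.norm_of_nonneg (Real.exp_pos _).le, Real.norm_of_nonneg (Real.exp_pos _).le]
  exact Real.exp_le_exp.2 (ht.trans_eq (by ring))

theorem tendsto_comp_neg_div {g : ℝ → ℝ} (hlim : Tendsto (fun t => g t / t) atBot (𝓝 0)) :
    Tendsto (fun t => g (-t) / t) atTop (𝓝 0) := by
  have h := (hlim.comp tendsto_neg_atTop_atBot).neg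
  simpa [Function.comp_def, div_neg] using h

theorem integrableOn_Iic_exp_linear_add_sublinear {g : ℝ → ℝ} (hg : Continuous g)
    (hlim : Tendsto (fun t => g t / t) atBot (𝓝 0)) {c : ℝ} (hc : 0 < c) (δ a : ℝ) :
    IntegrableOn (fun t => Real.exp (c * t + δ * g t)) (Iic a) := by
  have h := integrableOn_exp_linear_add_sublinear (g := fun t => g (-t)) (by fun_prop)
    (tendsto_comp_neg_div hlim) (c := -c) (by linarith) δ (-a)
  have h2 := h.comp_neg_Iic
  simpa using h2

end ExpWeight

/-! ## Recurrence is inherited by weighted averages -/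

namespace Recurrence

theorem holds_const {X : Type*} [PseudoMetricSpace X] (k : Recurrence) (x : X) :
    k.Holds fun _ : ℝ => x := by
  cases k with
  | periodic T hT => exact fun _ => rfl
  | almostPeriodic =>
    exact fun ε hε => ⟨1, one_pos, fun a => ⟨a, by simp, fun τ => by simpa using hε⟩⟩
  | almostAutomorphic =>
    exact fun u => ⟨id, strictMono_id, fun _ => x, fun τ => ⟨tendsto_const_nhds, tendsto_const_nhds⟩⟩

theorem Holds.neg {k : Recurrence} {f : ℝ → ℝ} (h : k.Holds f) : k.Holds fun τ => -f τ := by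
  cases k with
  | periodic T hT => exact fun τ => congrArg Neg.neg (h τ)
  | almostPeriodic =>
    intro ε hε
    obtain ⟨l, hl, H⟩ := h ε hε
    refine ⟨l, hl, fun a => ?_⟩
    obtain ⟨t₀, ht, H'⟩ := H a
    exact ⟨t₀, ht, fun τ => by rw [dist_neg_neg]; exact H' τ⟩
  | almostAutomorphic =>
    intro u
    obtain ⟨φ, hφ, ζ, H⟩ := h u
    exact ⟨φ, hφ, fun τ => -ζ τ, fun τ => ⟨(H τ).1.neg, (H τ).2.neg⟩⟩

theorem Holds.inv {k : Recurrence} {f : ℝ → ℝ} (h : k.Holds f) {c : ℝ} (hc : 0 < c)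
    (hf : ∀ τ, c ≤ f τ) : k.Holds fun τ => (f τ)⁻¹ := by
  cases k with
  | periodic T hT => exact fun τ => congrArg Inv.inv (h τ)
  | almostPeriodic =>
    intro ε hε
    -- Inversion is Lipschitz with constant `1 / (c * c)` on `[c, ∞)`.
    obtain ⟨l, hl, H⟩ := h (ε * (c * c)) (by positivity)
    refine ⟨l, hl, fun a => ?_⟩
    obtain ⟨t₀, ht, H'⟩ := H a
    refine ⟨t₀, ht, fun τ => ?_⟩
    have h1 := hc.trans_le (hf (τ + t₀))
    have h2 := hc.trans_le (hf τ)
    rw [dist_inv_inv₀ h1.ne' h2.ne', Real.norm_of_nonneg h1.le, Real.norm_of_nonneg h2.le,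
      div_lt_iff₀ (by positivity)]
    refine (H' τ).trans_le (mul_le_mul_of_nonneg_left ?_ hε.le)
    exact mul_le_mul (hf _) (hf _) hc.le h1.le
  | almostAutomorphic =>
    intro u
    obtain ⟨φ, hφ, ζ, H⟩ := h u
    have hζ : ∀ τ, c ≤ ζ τ := fun τ => ge_of_tendsto' (H τ).1 fun m => hf _
    exact ⟨φ, hφ, fun τ => (ζ τ)⁻¹, fun τ =>
      ⟨(H τ).1.inv₀ (hc.trans_le (hζ τ)).ne', (H τ).2.inv₀ (hc.trans_le (hf τ)).ne'⟩⟩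

/-- Translating `τ` translates `f` under the integral, so uniform closeness is preserved up to the
mass of `w`, and pointwise limits pass by dominated convergence. In the almost automorphic case the
limit `ζ` need not be continuous; it is bounded and measurable as a pointwise limit, which is enough
for the return limit. -/
theorem Holds.setIntegral {k : Recurrence} {f w : ℝ → ℝ} (h : k.Holds f) (hf : Continuous f)
    {C : ℝ} (hC : ∀ t, |f t| ≤ C) {S : Set ℝ} (hS : MeasurableSet S) (hw0 : ∀ r, 0 ≤ w r)
    (hw : IntegrableOn w S) : k.Holds fun τ => ∫ r in S, w r * f (r + τ) := by
  have hmul : ∀ {b : ℝ → ℝ}, AEStronglyMeasurable b (volume.restrict S) → (∀ r, |b r| ≤ C) →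
      IntegrableOn (fun r => w r * b r) S := fun hb hbC =>
    hw.mul_bdd (c := C) hb (Eventually.of_forall fun r => by simpa using hbC r)
  have hint : ∀ τ, IntegrableOn (fun r => w r * f (r + τ)) S := fun τ =>
    hmul (b := fun r => f (r + τ)) (by fun_prop) fun r => hC _
  cases k with
  | periodic T hT =>
    intro τ
    refine setIntegral_congr_fun hS fun r _ => ?_
    have := h (r + τ)
    simp only [← add_assoc, this]
  | almostPeriodic =>
    intro ε hε
    set I := ∫ r in S, w r with hI
    have hI0 : 0 ≤ I := setIntegral_nonneg hS fun r _ => hw0 r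
    -- `I + 1` rather than `I`: the weight may have zero mass.
    obtain ⟨l, hl, H⟩ := h (ε / (I + 1)) (by positivity)
    refine ⟨l, hl, fun a => ?_⟩
    obtain ⟨t₀, ht, H'⟩ := H a
    refine ⟨t₀, ht, fun τ => ?_⟩
    rw [Real.dist_eq, ← integral_sub (hint _) (hint _)]
    have hb : ‖∫ r in S, (w r * f (r + (τ + t₀)) - w r * f (r + τ))‖
        ≤ ∫ r in S, w r * (ε / (I + 1)) := by
      refine norm_integral_le_of_norm_le (hw.mul_const _) (Eventually.of_forall fun r => ?_)
      rw [← mul_sub, norm_mul, Real.norm_of_nonneg (hw0 r)]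
      refine mul_le_mul_of_nonneg_left ?_ (hw0 r)
      have := H' (r + τ)
      rw [add_assoc] at this
      exact this.le
    refine hb.trans_lt ?_
    rw [integral_mul_const, ← hI, mul_div_assoc', div_lt_iff₀ (by positivity)]
    nlinarith
  | almostAutomorphic =>
    intro u
    obtain ⟨φ, hφ, ζ, H⟩ := h u
    have hζC : ∀ τ, |ζ τ| ≤ C := fun τ => le_of_tendsto' (H τ).1.abs fun m => hC _
    have hζm : Measurable ζ :=
      measurable_of_tendsto_metrizable (f := fun m τ => f (τ + u (φ m))) (fun m => by fun_prop)
        (tendsto_pi_nhds.2 fun τ => (H τ).1)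
    refine ⟨φ, hφ, fun τ => ∫ r in S, w r * ζ (r + τ), fun τ => ⟨?_, ?_⟩⟩
    · refine tendsto_integral_of_dominated_convergence (fun r => w r * C)
        (fun m => (hint _).aestronglyMeasurable) (hw.mul_const C)
        (fun m => Eventually.of_forall fun r => ?_) (Eventually.of_forall fun r => ?_)
      · rw [norm_mul, Real.norm_of_nonneg (hw0 r)]
        exact mul_le_mul_of_nonneg_left (hC _) (hw0 r)
      · have := (H (r + τ)).1
        simp only [add_assoc] at this
        exact this.const_mul _
    · refine tendsto_integral_of_dominated_convergence (fun r => w r * C)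
        (fun m => (hmul (b := fun r => ζ (r + (τ - u (φ m))))
          (hζm.comp (by fun_prop)).aestronglyMeasurable fun r => hζC _).aestronglyMeasurable)
        (hw.mul_const C)
        (fun m => Eventually.of_forall fun r => ?_) (Eventually.of_forall fun r => ?_)
      · rw [norm_mul, Real.norm_of_nonneg (hw0 r)]
        exact mul_le_mul_of_nonneg_left (hζC _) (hw0 r)
      · have := (H (r + τ)).2
        simp only [add_sub_assoc] at this
        exact this.const_mul _

end Recurrence

/-! ## Blow-up of the exponential functionals as the rate tends to zero -/

/-- The limit is infinite, so only a lower bound is needed and Fatou's lemma gives it, with no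
monotonicity or domination in `c`. -/
theorem tendsto_setIntegral_exp_mul_atTop {l : Filter ℝ} [l.IsCountablyGenerated] (hl : l ≤ 𝓝 0)
    {h : ℝ → ℝ} (hh : Measurable h) (h0 : ∀ r, 0 ≤ h r) {S : Set ℝ}
    (hint : ∀ᶠ c in l, IntegrableOn (fun r => Real.exp (c * r) * h r) S)
    (htop : ∫⁻ r in S, ENNReal.ofReal (h r) = ∞) :
    Tendsto (fun c => ∫ r in S, Real.exp (c * r) * h r) l atTop := by
  rw [← ENNReal.tendsto_ofReal_nhds_top]
  have hlim : Tendsto (fun c => ∫⁻ r in S, ENNReal.ofReal (Real.exp (c * r) * h r)) l (𝓝 ∞) := by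
    rcases eq_or_neBot l with rfl | hne
    · exact tendsto_bot
    refine tendsto_of_le_liminf_of_limsup_le ?_ le_top
    rw [← htop]
    refine le_trans (lintegral_mono fun r => ?_) (lintegral_liminf_le fun c => by fun_prop)
    have : Tendsto (fun c => ENNReal.ofReal (Real.exp (c * r) * h r)) l
        (𝓝 (ENNReal.ofReal (h r))) := by
      refine (ENNReal.continuous_ofReal.tendsto _).comp ?_
      have hc : Continuous fun c : ℝ => Real.exp (c * r) * h r := by fun_prop
      have := (hc.tendsto 0).mono_left hl
      simpa using this
    exact this.liminf_eq.ge
  refine hlim.congr' ?_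
  filter_upwards [hint] with c hc
  rw [ofReal_integral_eq_lintegral_ofReal hc
    (Eventually.of_forall fun r => mul_nonneg (Real.exp_pos _).le (h0 r))]

/-! ## The cocycle -/

namespace Transcritical

variable {lam δ : ℝ} {β : ℝ → ℝ}

/-- Since `ω 0 = 0`, the shift by `-τ` moves the starting time to `0` and an exponential factors
out, so that survival depends only on the sign of the bracket. -/
theorem denom_shift (ω : WienerPath) (t τ x : ℝ) :
    denom lam δ β (t + τ) τ (WienerPath.shift (-τ) ω) x =
      Real.exp (-(lam * t + δ * ω t)) *
        (1 + x * ∫ r in (0 : ℝ)..t, Real.exp (lam * r + δ * ω r) * β (r + τ)) := by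
  have h1 : ∫ r in τ..t + τ, Real.exp (lam * (r - (t + τ)) +
        δ * (WienerPath.shift (-τ) ω r - WienerPath.shift (-τ) ω (t + τ))) * β r =
      Real.exp (-(lam * t + δ * ω t)) *
        ∫ r in (0 : ℝ)..t, Real.exp (lam * r + δ * ω r) * β (r + τ) := by
    rw [← intervalIntegral.integral_const_mul]
    have := intervalIntegral.integral_comp_add_right (a := 0) (b := t)
      (fun r => Real.exp (lam * (r - (t + τ)) +
        δ * (WienerPath.shift (-τ) ω r - WienerPath.shift (-τ) ω (t + τ))) * β r) τ
    rw [zero_add] at this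
    rw [← this]
    refine intervalIntegral.integral_congr fun r _ => ?_
    simp only [WienerPath.shift_apply, ← mul_assoc, ← Real.exp_add]
    congr 2
    have e1 : r + τ + -τ = r := by ring
    have e2 : t + τ + -τ = t := by ring
    rw [e1, e2]
    ring
  have h2 : lam * (τ - (t + τ)) + δ * (WienerPath.shift (-τ) ω τ - WienerPath.shift (-τ) ω (t + τ))
      = -(lam * t + δ * ω t) := by
    simp only [WienerPath.shift_apply]
    have e1 : τ + -τ = 0 := by ring
    have e2 : t + τ + -τ = t := by ring
    rw [e1, e2, ω.map_zero]
    ring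
  rw [denom, h1, h2]
  ring

theorem mem_cocycle_iff {t τ x y : ℝ} {ω : RegularPath δ} :
    y ∈ cocycle lam δ β t τ ω x ↔
      0 < 1 + x * (∫ r in (0 : ℝ)..t, Real.exp (lam * r + δ * ω.1 r) * β (r + τ)) ∧
      y = x / (Real.exp (-(lam * t + δ * ω.1 t)) *
        (1 + x * ∫ r in (0 : ℝ)..t, Real.exp (lam * r + δ * ω.1 r) * β (r + τ))) := by
  have h := denom_shift (lam := lam) (δ := δ) (β := β) ω.1 t τ x
  simp only [cocycle, Part.mem_mk_iff, alive, mem_ofPred_eq, sol, h]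
  rw [mul_pos_iff_of_pos_left (Real.exp_pos _), exists_prop, eq_comm (a := y)]

theorem zero_mem_cocycle (t τ : ℝ) (ω : RegularPath δ) : (0 : ℝ) ∈ cocycle lam δ β t τ ω 0 :=
  mem_cocycle_iff.2 (by simp)

/-- In pullback form the integrand no longer depends on `t`, only the lower limit does; this is what
makes limits as `t → ∞` accessible. -/
theorem mem_cocycle_pullback (hβ : ∀ t, 0 ≤ β t) {t x : ℝ} (ht : 0 ≤ t) (hx : 0 ≤ x) (τ : ℝ)
    (ω : RegularPath δ) :
    x / (Real.exp (-(lam * t) + δ * ω.1 (-t)) +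
        x * ∫ r in -t..0, Real.exp (lam * r + δ * ω.1 r) * β (r + τ)) ∈
      cocycle lam δ β t (τ - t) (RegularPath.shift (-t) ω) x := by
  have h1 : ∫ r in (0 : ℝ)..t, Real.exp (lam * r + δ * (RegularPath.shift (-t) ω).1 r) *
        β (r + (τ - t)) =
      Real.exp (lam * t - δ * ω.1 (-t)) *
        ∫ r in -t..0, Real.exp (lam * r + δ * ω.1 r) * β (r + τ) := by
    rw [← intervalIntegral.integral_const_mul]
    have := intervalIntegral.integral_comp_add_right (a := 0) (b := t)
      (fun r => Real.exp (lam * t - δ * ω.1 (-t)) *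
        (Real.exp (lam * r + δ * ω.1 r) * β (r + τ))) (-t)
    rw [zero_add, add_neg_cancel] at this
    rw [← this]
    refine intervalIntegral.integral_congr fun r _ => ?_
    simp only [RegularPath.shift, WienerPath.shift_apply, ← mul_assoc, ← Real.exp_add]
    congr 2
    · ring
    · ring
  rw [mem_cocycle_iff, h1]
  have hI : 0 ≤ ∫ r in -t..0, Real.exp (lam * r + δ * ω.1 r) * β (r + τ) :=
    intervalIntegral.integral_nonneg (by linarith) fun r _ =>
      mul_nonneg (Real.exp_pos _).le (hβ _)
  refine ⟨by positivity, ?_⟩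
  have h2 : (RegularPath.shift (-t) ω).1 t = -ω.1 (-t) := by
    simp [RegularPath.shift, ω.1.map_zero]
  rw [h2, mul_add, mul_one, mul_left_comm, ← mul_assoc (Real.exp _) (Real.exp _), ← Real.exp_add]
  congr 3
  · ring_nf
  · have : -(lam * t + δ * -ω.1 (-t)) + (lam * t - δ * ω.1 (-t)) = 0 := by ring
    rw [this, Real.exp_zero, one_mul]

/-! ### The nontrivial random solution -/

section Weight

variable {β₀ β₁ : ℝ}

theorem integrableOn_weight_Iic (hlam : 0 < lam) (ω : RegularPath δ) (a : ℝ) :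
    IntegrableOn (fun r => Real.exp (lam * r + δ * ω.1 r)) (Iic a) :=
  integrableOn_Iic_exp_linear_add_sublinear ω.1.continuous ω.2.sublinear_atBot hlam δ a

theorem integrableOn_weight_Ici (hlam : lam < 0) (ω : RegularPath δ) (a : ℝ) :
    IntegrableOn (fun r => Real.exp (lam * r + δ * ω.1 r)) (Ici a) :=
  integrableOn_exp_linear_add_sublinear ω.1.continuous ω.2.sublinear_atTop hlam δ a

theorem integrableOn_weight_mul (hβ : Continuous β) (hβ₀ : 0 < β₀)
    (hbound : ∀ t, β₀ ≤ β t ∧ β t ≤ β₁) {ω : RegularPath δ} {S : Set ℝ}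
    (h : IntegrableOn (fun r => Real.exp (lam * r + δ * ω.1 r)) S) (τ : ℝ) :
    IntegrableOn (fun r => Real.exp (lam * r + δ * ω.1 r) * β (r + τ)) S :=
  h.mul_bdd (c := β₁) (by fun_prop) (Eventually.of_forall fun r => by
    rw [Real.norm_of_nonneg (hβ₀.le.trans (hbound _).1)]; exact (hbound _).2)

theorem le_setIntegral_weight (hβ : Continuous β) (hβ₀ : 0 < β₀)
    (hbound : ∀ t, β₀ ≤ β t ∧ β t ≤ β₁) {ω : RegularPath δ} {S : Set ℝ} (hS : MeasurableSet S)
    (h : IntegrableOn (fun r => Real.exp (lam * r + δ * ω.1 r)) S) (τ : ℝ) :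
    (∫ r in S, Real.exp (lam * r + δ * ω.1 r)) * β₀ ≤
      ∫ r in S, Real.exp (lam * r + δ * ω.1 r) * β (r + τ) := by
  rw [← integral_mul_const]
  exact setIntegral_mono_on (h.mul_const _) (integrableOn_weight_mul hβ hβ₀ hbound h τ) hS
    fun r _ => mul_le_mul_of_nonneg_left (hbound _).1 (Real.exp_pos _).le

theorem setIntegral_weight_pos {ω : RegularPath δ} {S : Set ℝ} (hS : volume S ≠ 0)
    (h : IntegrableOn (fun r => Real.exp (lam * r + δ * ω.1 r)) S) :
    0 < ∫ r in S, Real.exp (lam * r + δ * ω.1 r) := by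
  have : NeZero (volume.restrict S) := ⟨by rwa [Ne, Measure.restrict_eq_zero]⟩
  exact integral_exp_pos h

theorem setIntegral_weight_mul_pos (hβ : Continuous β) (hβ₀ : 0 < β₀)
    (hbound : ∀ t, β₀ ≤ β t ∧ β t ≤ β₁) {ω : RegularPath δ} {S : Set ℝ} (hS : MeasurableSet S)
    (hS0 : volume S ≠ 0)
    (h : IntegrableOn (fun r => Real.exp (lam * r + δ * ω.1 r)) S) (τ : ℝ) :
    0 < ∫ r in S, Real.exp (lam * r + δ * ω.1 r) * β (r + τ) :=
  (mul_pos (setIntegral_weight_pos hS0 h) hβ₀).trans_le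
    (le_setIntegral_weight hβ hβ₀ hbound hS h τ)

theorem holds_inv_setIntegral_weight {k : Recurrence} (hk : k.Holds β) (hβ : Continuous β)
    (hβ₀ : 0 < β₀) (hbound : ∀ t, β₀ ≤ β t ∧ β t ≤ β₁) {ω : RegularPath δ} {S : Set ℝ}
    (hS : MeasurableSet S) (hS0 : volume S ≠ 0)
    (h : IntegrableOn (fun r => Real.exp (lam * r + δ * ω.1 r)) S) :
    k.Holds fun τ => (∫ r in S, Real.exp (lam * r + δ * ω.1 r) * β (r + τ))⁻¹ :=
  (hk.setIntegral hβ (C := β₁)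
    (fun t => by rw [abs_of_nonneg (hβ₀.le.trans (hbound t).1)]; exact (hbound t).2)
    hS (fun r => (Real.exp_pos _).le) h).inv
    (mul_pos (setIntegral_weight_pos hS0 h) hβ₀) fun τ =>
      le_setIntegral_weight hβ hβ₀ hbound hS h τ

theorem measurable_eval (t : ℝ) : Measurable fun ω : WienerPath => ω t :=
  Continuous.measurable (α := WienerPath)
    ((continuous_eval_const (F := C(ℝ, ℝ)) t).comp continuous_subtype_val)

theorem measurable_uncurry_eval : Measurable fun p : ℝ × WienerPath => p.2 p.1 :=
  measurable_uncurry_of_continuous_of_measurable (u := fun (t : ℝ) (ω : WienerPath) => ω t)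
    (fun ω => ω.continuous)
    measurable_eval

theorem measurable_setIntegral_weight (hβ : Continuous β) (S : Set ℝ) (τ : ℝ) :
    Measurable fun ω : RegularPath δ =>
      ∫ r in S, Real.exp (lam * r + δ * ω.1 r) * β (r + τ) := by
  have h : Measurable fun p : RegularPath δ × ℝ => p.1.1 p.2 :=
    measurable_uncurry_eval.comp
      (f := fun p : RegularPath δ × ℝ => ((p.2, p.1.1) : ℝ × WienerPath)) (by fun_prop)
  have h2 : Measurable fun p : RegularPath δ × ℝ =>
      Real.exp (lam * p.2 + δ * p.1.1 p.2) * β (p.2 + τ) := by fun_prop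
  exact (h2.stronglyMeasurable.integral_prod_right' (ν := volume.restrict S)).measurable

/-- The source of the invariance of `xBif`: the noise shift contributes exactly the exponential
factor that appears in the cocycle. -/
theorem setIntegral_weight_shift (S : Set ℝ) (ω : RegularPath δ) (t τ : ℝ) :
    ∫ r in (· + t) ⁻¹' S, Real.exp (lam * r + δ * (RegularPath.shift t ω).1 r) *
        β (r + (τ + t)) =
      Real.exp (-(lam * t + δ * ω.1 t)) *
        ∫ r in S, Real.exp (lam * r + δ * ω.1 r) * β (r + τ) := by
  have h := (measurePreserving_add_right volume t).setIntegral_preimage_emb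
    (MeasurableEquiv.addRight t).measurableEmbedding
    (fun r => Real.exp (lam * r + δ * ω.1 r) * β (r + τ)) S
  rw [← h, ← MeasureTheory.integral_const_mul]
  refine integral_congr_ae (Eventually.of_forall fun r => ?_)
  simp only [RegularPath.shift, WienerPath.shift_apply, ← mul_assoc, ← Real.exp_add]
  congr 2
  · ring
  · ring

end Weight

end Transcritical

namespace Transcritical

variable {lam δ : ℝ} {β : ℝ → ℝ} {β₀ β₁ : ℝ}

theorem xBif_of_pos (hlam : 0 < lam) (τ : ℝ) (ω : RegularPath δ) :
    xBif lam δ β τ ω = (∫ r in Iic (0 : ℝ), Real.exp (lam * r + δ * ω.1 r) * β (r + τ))⁻¹ :=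
  if_pos hlam

theorem xBif_of_neg (hlam : lam < 0) (τ : ℝ) (ω : RegularPath δ) :
    xBif lam δ β τ ω = -(∫ r in Ici (0 : ℝ), Real.exp (lam * r + δ * ω.1 r) * β (r + τ))⁻¹ :=
  if_neg hlam.not_gt

theorem xBif_pos (hβ : Continuous β) (hβ₀ : 0 < β₀) (hbound : ∀ t, β₀ ≤ β t ∧ β t ≤ β₁)
    (hlam : 0 < lam) (τ : ℝ) (ω : RegularPath δ) : 0 < xBif lam δ β τ ω := by
  rw [xBif_of_pos hlam]
  exact inv_pos.2 (setIntegral_weight_mul_pos hβ hβ₀ hbound measurableSet_Iic (by simp)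
    (integrableOn_weight_Iic hlam ω 0) τ)

theorem xBif_neg (hβ : Continuous β) (hβ₀ : 0 < β₀) (hbound : ∀ t, β₀ ≤ β t ∧ β t ≤ β₁)
    (hlam : lam < 0) (τ : ℝ) (ω : RegularPath δ) : xBif lam δ β τ ω < 0 := by
  rw [xBif_of_neg hlam]
  exact neg_neg_iff_pos.2 (inv_pos.2 (setIntegral_weight_mul_pos hβ hβ₀ hbound measurableSet_Ici
    (by simp) (integrableOn_weight_Ici hlam ω 0) τ))

theorem isRandomRecurrentSolution_zero (k : Recurrence) :
    IsRandomRecurrentSolution k RegularPath.shift (cocycle lam δ β) (fun _ _ => 0) where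
  measurable _ := measurable_const
  isCompleteQuasiSolution t _ τ ω := zero_mem_cocycle t τ ω
  recurrent _ := k.holds_const 0

theorem isRandomRecurrentSolution_xBif_of_pos {k : Recurrence} (hk : k.Holds β)
    (hβ : Continuous β) (hβ₀ : 0 < β₀) (hbound : ∀ t, β₀ ≤ β t ∧ β t ≤ β₁) (hlam : 0 < lam) :
    IsRandomRecurrentSolution k RegularPath.shift (cocycle lam δ β) (xBif lam δ β) where
  measurable τ := by
    simp only [funext (xBif_of_pos hlam τ)]
    exact (measurable_setIntegral_weight hβ _ τ).inv
  isCompleteQuasiSolution t ht τ ω := by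
    have hw := integrableOn_weight_Iic hlam ω
    have hpos := setIntegral_weight_mul_pos hβ hβ₀ hbound measurableSet_Iic (S := Iic 0)
      (by simp) (hw 0) τ
    have hsub := intervalIntegral.integral_Iic_sub_Iic
      (integrableOn_weight_mul hβ hβ₀ hbound (hw 0) τ)
      (integrableOn_weight_mul hβ hβ₀ hbound (hw t) τ)
    have hA : 0 ≤ ∫ r in (0 : ℝ)..t, Real.exp (lam * r + δ * ω.1 r) * β (r + τ) :=
      intervalIntegral.integral_nonneg ht fun r _ =>
        mul_nonneg (Real.exp_pos _).le (hβ₀.le.trans (hbound _).1)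
    have hshift := setIntegral_weight_shift (lam := lam) (β := β) (Iic t) ω t τ
    rw [show (fun r : ℝ => r + t) ⁻¹' Iic t = Iic 0 by ext; simp] at hshift
    rw [mem_cocycle_iff, xBif_of_pos hlam, xBif_of_pos hlam, hshift, ← hsub]
    rw [← hsub] at hA
    set I := ∫ r in Iic 0, Real.exp (lam * r + δ * ω.1 r) * β (r + τ)
    set J := ∫ r in Iic t, Real.exp (lam * r + δ * ω.1 r) * β (r + τ)
    have hJ : 0 < J := by linarith
    -- Starting from `I⁻¹`, the bracket in the denominator collapses, leaving the shifted value of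
    -- `xBif`.
    have h1 : 1 + I⁻¹ * (J - I) = I⁻¹ * J := by field_simp; ring
    rw [h1]
    refine ⟨by positivity, ?_⟩
    have := Real.exp_pos (-(lam * t + δ * ω.1 t))
    field_simp
  recurrent ω := by
    simp only [xBif_of_pos hlam]
    exact holds_inv_setIntegral_weight hk hβ hβ₀ hbound measurableSet_Iic (by simp)
      (integrableOn_weight_Iic hlam ω 0)

theorem isRandomRecurrentSolution_xBif_of_neg {k : Recurrence} (hk : k.Holds β)
    (hβ : Continuous β) (hβ₀ : 0 < β₀) (hbound : ∀ t, β₀ ≤ β t ∧ β t ≤ β₁) (hlam : lam < 0) :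
    IsRandomRecurrentSolution k RegularPath.shift (cocycle lam δ β) (xBif lam δ β) where
  measurable τ := by
    simp only [funext (xBif_of_neg hlam τ)]
    exact (measurable_setIntegral_weight hβ _ τ).inv.neg
  isCompleteQuasiSolution t ht τ ω := by
    have hw := integrableOn_weight_Ici hlam ω
    have hpos := setIntegral_weight_mul_pos hβ hβ₀ hbound measurableSet_Ici (S := Ici 0)
      (by simp) (hw 0) τ
    have hJ := setIntegral_weight_mul_pos hβ hβ₀ hbound measurableSet_Ici (S := Ici t)
      (by simp) (hw t) τ
    have hsub := intervalIntegral.integral_Ici_sub_Ici'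
      (integrableOn_weight_mul hβ hβ₀ hbound (hw 0) τ)
      (integrableOn_weight_mul hβ hβ₀ hbound (hw t) τ)
    have hshift := setIntegral_weight_shift (lam := lam) (β := β) (Ici t) ω t τ
    rw [show (fun r : ℝ => r + t) ⁻¹' Ici t = Ici 0 by ext; simp] at hshift
    rw [mem_cocycle_iff, xBif_of_neg hlam, xBif_of_neg hlam, hshift, ← hsub]
    set I := ∫ r in Ici 0, Real.exp (lam * r + δ * ω.1 r) * β (r + τ)
    set J := ∫ r in Ici t, Real.exp (lam * r + δ * ω.1 r) * β (r + τ)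
    -- The negative solution never explodes because the tail integral `J` stays positive: the
    -- bracket approaches zero without reaching it.
    have h1 : 1 + -I⁻¹ * (I - J) = I⁻¹ * J := by field_simp; ring
    rw [h1]
    refine ⟨by positivity, ?_⟩
    have := Real.exp_pos (-(lam * t + δ * ω.1 t))
    field_simp
  recurrent ω := by
    simp only [xBif_of_neg hlam]
    exact (holds_inv_setIntegral_weight hk hβ hβ₀ hbound measurableSet_Ici (by simp)
      (integrableOn_weight_Ici hlam ω 0)).neg

/-! ### Stability and attraction -/

theorem tendsto_exp_pullback_of_pos (hlam : 0 < lam) (ω : RegularPath δ) :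
    Tendsto (fun t => Real.exp (-(lam * t) + δ * ω.1 (-t))) atTop (𝓝 0) := by
  simpa using tendsto_exp_linear_add_sublinear (tendsto_comp_neg_div ω.2.sublinear_atBot)
    (neg_lt_zero.2 hlam) δ

theorem tendsto_exp_pullback_of_neg (hlam : lam < 0) (ω : RegularPath δ) :
    Tendsto (fun t => (Real.exp (-(lam * t) + δ * ω.1 (-t)))⁻¹) atTop (𝓝 0) := by
  refine (tendsto_exp_linear_add_sublinear (tendsto_comp_neg_div ω.2.sublinear_atBot)
    hlam (-δ)).congr fun t => ?_
  rw [← Real.exp_neg]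
  congr 1
  ring

/-- For nonnegative data the quadratic term only damps, so the linear flow dominates. -/
theorem pullback_value_le (hβ : ∀ t, 0 ≤ β t) {t x : ℝ} (ht : 0 ≤ t) (hx : 0 ≤ x) (τ : ℝ)
    (ω : RegularPath δ) :
    x / (Real.exp (-(lam * t) + δ * ω.1 (-t)) +
        x * ∫ r in -t..0, Real.exp (lam * r + δ * ω.1 r) * β (r + τ)) ≤
      x * (Real.exp (-(lam * t) + δ * ω.1 (-t)))⁻¹ := by
  have hI : 0 ≤ ∫ r in -t..0, Real.exp (lam * r + δ * ω.1 r) * β (r + τ) :=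
    intervalIntegral.integral_nonneg (by linarith) fun r _ =>
      mul_nonneg (Real.exp_pos _).le (hβ _)
  rw [div_eq_mul_inv]
  refine mul_le_mul_of_nonneg_left (inv_anti₀ (Real.exp_pos _) ?_) hx
  exact le_add_of_nonneg_right (mul_nonneg hx hI)

theorem pullback_value_pos (hβ : ∀ t, 0 ≤ β t) {t x : ℝ} (ht : 0 ≤ t) (hx : 0 < x) (τ : ℝ)
    (ω : RegularPath δ) :
    0 < x / (Real.exp (-(lam * t) + δ * ω.1 (-t)) +
        x * ∫ r in -t..0, Real.exp (lam * r + δ * ω.1 r) * β (r + τ)) := by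
  have hI : 0 ≤ ∫ r in -t..0, Real.exp (lam * r + δ * ω.1 r) * β (r + τ) :=
    intervalIntegral.integral_nonneg (by linarith) fun r _ =>
      mul_nonneg (Real.exp_pos _).le (hβ _)
  positivity

theorem pullbackAttracts_zero (hβ : ∀ t, 0 ≤ β t) (hlam : lam < 0) {K : Set ℝ}
    (hK : IsCompact K) (hK0 : K ⊆ Ioi 0) :
    PullbackAttracts RegularPath.shift (cocycle lam δ β) (fun _ _ => 0) K := by
  intro τ ω ε hε
  obtain ⟨M, hM⟩ := hK.bddAbove
  have h := (tendsto_exp_pullback_of_neg hlam ω).const_mul (max M 0)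
  rw [mul_zero] at h
  filter_upwards [h.eventually (gt_mem_nhds hε), eventually_ge_atTop 0] with t ht ht0 x hx
  have hx0 : 0 < x := hK0 hx
  refine ⟨_, mem_cocycle_pullback hβ ht0 hx0.le τ ω, ?_⟩
  rw [Real.dist_0_eq_abs, abs_of_pos (pullback_value_pos hβ ht0 hx0 τ ω)]
  refine (pullback_value_le hβ ht0 hx0.le τ ω).trans_lt (lt_of_le_of_lt ?_ ht)
  exact mul_le_mul_of_nonneg_right ((hM hx).trans (le_max_left _ _))
    (inv_nonneg.2 (Real.exp_pos _).le)

theorem isPullbackLyapunovStable_zero (hβ : ∀ t, 0 ≤ β t) (hlam : lam < 0) :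
    IsPullbackLyapunovStable RegularPath.shift (cocycle lam δ β) 0 (Ioi 0) := by
  intro τ ω ε hε
  -- The linear growth factor is continuous and tends to `0`, hence is bounded on `[0, ∞)`; its
  -- bound fixes the radius `η`.
  set e : ℝ → ℝ := fun t => (Real.exp (-(lam * t) + δ * ω.1 (-t)))⁻¹ with he
  have hec : Continuous e := by
    have := ω.1.continuous
    exact Continuous.inv₀ (by fun_prop) fun _ => (Real.exp_pos _).ne'
  obtain ⟨a, ha⟩ := eventually_atTop.1
    ((tendsto_exp_pullback_of_neg hlam ω).eventually (gt_mem_nhds one_pos))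
  obtain ⟨C, hC⟩ := (isCompact_Icc (a := 0) (b := a)).bddAbove_image hec.continuousOn
  have hbd : ∀ t, 0 ≤ t → e t ≤ max C 1 := fun t ht => by
    rcases le_total t a with h | h
    · exact (hC (mem_image_of_mem e ⟨ht, h⟩)).trans (le_max_left _ _)
    · exact (ha t h).le.trans (le_max_right _ _)
  have hC1 : 0 < max C 1 := lt_max_of_lt_right one_pos
  refine ⟨ε / max C 1, div_pos hε hC1, fun t ht x hx => ?_⟩
  have hx0 : 0 < x := hx.2
  have hxη : x < ε / max C 1 := by simpa [abs_of_pos hx0] using hx.1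
  refine ⟨_, mem_cocycle_pullback hβ ht hx0.le τ ω, ?_, pullback_value_pos hβ ht hx0 τ ω⟩
  rw [Metric.mem_ball, Real.dist_0_eq_abs, abs_of_pos (pullback_value_pos hβ ht hx0 τ ω)]
  refine (pullback_value_le hβ ht hx0.le τ ω).trans_lt ?_
  calc x * e t ≤ x * max C 1 := mul_le_mul_of_nonneg_left (hbd t ht) hx0.le
    _ < ε := (lt_div_iff₀ hC1).1 hxη

theorem isPullbackAsymptoticallyStable_zero (hβ : ∀ t, 0 ≤ β t) (hlam : lam < 0) :
    IsPullbackAsymptoticallyStable RegularPath.shift (cocycle lam δ β) 0 (Ioi 0) where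
  isFixedPoint t _ τ ω := zero_mem_cocycle t τ ω
  stable := isPullbackLyapunovStable_zero hβ hlam
  attracts _ hx := pullbackAttracts_zero hβ hlam isCompact_singleton
    (singleton_subset_iff.2 hx)

/-- A factor `x` cancels between numerator and denominator, so the bound depends only on the lower
bound `m`: this gives uniformity over compact subsets of `(0, ∞)`. -/
theorem abs_div_add_mul_sub_inv_le {x m a I J : ℝ} (hm : 0 < m) (hx : m ≤ x) (ha : 0 < a)
    (hI : 0 < I) (hJ : 0 < J) :
    |x / (a + x * J) - I⁻¹| ≤ (|I - J| + a / m) / (J * I) := by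
  have hx0 : 0 < x := hm.trans_le hx
  have hD : 0 < a + x * J := by positivity
  have h1 : x / (a + x * J) - I⁻¹ = (x * (I - J) - a) / ((a + x * J) * I) := by
    field_simp
    ring
  rw [h1, abs_div, abs_of_pos (by positivity : 0 < (a + x * J) * I)]
  have h2 : |x * (I - J) - a| ≤ x * (|I - J| + a / m) := by
    have e1 : |x * (I - J) - a| ≤ |x * (I - J)| + |a| := abs_sub _ _
    rw [abs_mul, abs_of_pos hx0, abs_of_pos ha] at e1
    have e2 : a ≤ x * (a / m) := by
      rw [mul_div_assoc', le_div_iff₀ hm, mul_comm]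
      exact mul_le_mul_of_nonneg_right hx ha.le
    linarith
  rw [div_le_div_iff₀ (by positivity) (by positivity)]
  have h3 : 0 ≤ |I - J| + a / m := by positivity
  calc |x * (I - J) - a| * (J * I) ≤ x * (|I - J| + a / m) * (J * I) :=
        mul_le_mul_of_nonneg_right h2 (by positivity)
    _ = (|I - J| + a / m) * ((x * J) * I) := by ring
    _ ≤ (|I - J| + a / m) * ((a + x * J) * I) := by gcongr; linarith

theorem pullbackAttracts_xBif (hβ : Continuous β) (hβ₀ : 0 < β₀)
    (hbound : ∀ t, β₀ ≤ β t ∧ β t ≤ β₁) (hlam : 0 < lam) {K : Set ℝ}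
    (hK : IsCompact K) (hK0 : K ⊆ Ioi 0) :
    PullbackAttracts RegularPath.shift (cocycle lam δ β) (xBif lam δ β) K := by
  intro τ ω ε hε
  obtain ⟨m, hm, hmK⟩ : ∃ m : ℝ, 0 < m ∧ ∀ x ∈ K, m ≤ x := by
    rcases K.eq_empty_or_nonempty with rfl | hne
    · exact ⟨1, one_pos, by simp⟩
    · obtain ⟨m, hmK, hm⟩ := hK.exists_isLeast hne
      exact ⟨m, hK0 hmK, fun x hx => hm hx⟩
  have hβ0 : ∀ t, 0 ≤ β t := fun t => hβ₀.le.trans (hbound t).1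
  have hw := integrableOn_weight_Iic hlam ω 0
  have hIpos := setIntegral_weight_mul_pos hβ hβ₀ hbound measurableSet_Iic (by simp) hw τ
  rw [xBif_of_pos hlam]
  set I := ∫ r in Iic 0, Real.exp (lam * r + δ * ω.1 r) * β (r + τ)
  set J : ℝ → ℝ := fun t => ∫ r in -t..0, Real.exp (lam * r + δ * ω.1 r) * β (r + τ) with hJdef
  have hJ : Tendsto J atTop (𝓝 I) := intervalIntegral_tendsto_integral_Iic 0
    (integrableOn_weight_mul hβ hβ₀ hbound hw τ) tendsto_neg_atTop_atBot
  have hlim : Tendsto (fun t =>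
      (|I - J t| + Real.exp (-(lam * t) + δ * ω.1 (-t)) / m) / (J t * I)) atTop (𝓝 0) := by
    have := ((((tendsto_const_nhds (x := I)).sub hJ).abs).add
      ((tendsto_exp_pullback_of_pos hlam ω).div_const m)).div (hJ.mul_const I)
      (mul_pos hIpos hIpos).ne'
    simpa [Pi.div_def] using this
  filter_upwards [hlim.eventually (gt_mem_nhds hε), eventually_ge_atTop 0,
    hJ.eventually (lt_mem_nhds hIpos)] with t ht ht0 hJt x hx
  refine ⟨_, mem_cocycle_pullback hβ0 ht0 (hK0 hx).le τ ω, ?_⟩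
  rw [Real.dist_eq]
  exact (abs_div_add_mul_sub_inv_le hm (hmK x hx) (Real.exp_pos _) hIpos hJt).trans_lt ht

theorem isPullbackUnstable_zero [Nonempty (RegularPath δ)] (hβ : Continuous β) (hβ₀ : 0 < β₀)
    (hbound : ∀ t, β₀ ≤ β t ∧ β t ≤ β₁) (hlam : 0 < lam) :
    IsPullbackUnstable RegularPath.shift (cocycle lam δ β) 0 (Ioi 0) where
  isFixedPoint t _ τ ω := zero_mem_cocycle t τ ω
  not_stable hstab := by
    obtain ⟨ω⟩ := ‹Nonempty (RegularPath δ)›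
    have hpos := xBif_pos hβ hβ₀ hbound hlam 0 ω
    -- With tolerance half of `xBif`, stability keeps the orbit from `η / 2` near `0` while
    -- attraction brings it within the same distance of `xBif`; the triangle inequality excludes
    -- both.
    obtain ⟨η, hη, H⟩ := hstab 0 ω _ (half_pos hpos)
    have hat := pullbackAttracts_xBif hβ hβ₀ hbound hlam (δ := δ)
      (isCompact_singleton (x := η / 2)) (singleton_subset_iff.2 (half_pos hη)) 0 ω _
      (half_pos hpos)
    obtain ⟨t, ht, ht0⟩ := (hat.and (eventually_ge_atTop 0)).exists
    obtain ⟨y, hy, hyd⟩ := ht (η / 2) rfl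
    obtain ⟨z, hz, hzb, -⟩ := H t ht0 (η / 2)
      ⟨by simp [abs_of_pos hη, hη], half_pos hη⟩
    obtain rfl := Part.mem_unique hy hz
    rw [Metric.mem_ball, dist_comm] at hzb
    have := dist_triangle_left 0 (xBif lam δ β 0 ω) y
    rw [dist_comm, Real.dist_0_eq_abs, abs_of_pos hpos, dist_comm y 0] at this
    linarith

/-! ### Behaviour at the bifurcation point -/

theorem lintegral_weight_mul_eq_top (hβ₀ : 0 < β₀) (hbound : ∀ t, β₀ ≤ β t ∧ β t ≤ β₁)
    {ω : WienerPath} {S : Set ℝ}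
    (h : ∫⁻ s in S, ENNReal.ofReal (Real.exp (δ * ω s)) = ∞) (τ : ℝ) :
    ∫⁻ s in S, ENNReal.ofReal (Real.exp (δ * ω s) * β (s + τ)) = ∞ := by
  have h1 : ∫⁻ s in S, ENNReal.ofReal β₀ * ENNReal.ofReal (Real.exp (δ * ω s)) = ∞ := by
    rw [lintegral_const_mul' _ _ ENNReal.ofReal_ne_top, h]
    exact ENNReal.mul_top (by simpa using hβ₀)
  refine top_le_iff.1 (h1.ge.trans (lintegral_mono fun s => ?_))
  rw [← ENNReal.ofReal_mul hβ₀.le]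
  refine ENNReal.ofReal_le_ofReal ?_
  rw [mul_comm]
  exact mul_le_mul_of_nonneg_left (hbound _).1 (Real.exp_pos _).le

theorem tendsto_inv_setIntegral_weight (hβ : Continuous β) (hβ₀ : 0 < β₀)
    (hbound : ∀ t, β₀ ≤ β t ∧ β t ≤ β₁) {ω : RegularPath δ} {S : Set ℝ} {l : Filter ℝ}
    [l.IsCountablyGenerated] (hl : l ≤ 𝓝 0)
    (hint : ∀ᶠ c in l, IntegrableOn (fun r => Real.exp (c * r + δ * ω.1 r)) S)
    (h : ∫⁻ s in S, ENNReal.ofReal (Real.exp (δ * ω.1 s)) = ∞) (τ : ℝ) :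
    Tendsto (fun c => (∫ r in S, Real.exp (c * r + δ * ω.1 r) * β (r + τ))⁻¹) l (𝓝 0) := by
  have hω := ω.1.continuous
  have key := tendsto_setIntegral_exp_mul_atTop (S := S) hl
    (h := fun r => Real.exp (δ * ω.1 r) * β (r + τ)) (by fun_prop)
    (fun r => mul_nonneg (Real.exp_pos _).le (hβ₀.le.trans (hbound _).1))
    (hint.mono fun c hc => by
      simpa only [← mul_assoc, ← Real.exp_add] using integrableOn_weight_mul hβ hβ₀ hbound hc τ)
    (lintegral_weight_mul_eq_top hβ₀ hbound h τ)
  simp only [← mul_assoc, ← Real.exp_add] at key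
  exact tendsto_inv_atTop_zero.comp key

theorem tendsto_xBif_nhdsGT (hβ : Continuous β) (hβ₀ : 0 < β₀)
    (hbound : ∀ t, β₀ ≤ β t ∧ β t ≤ β₁) (τ : ℝ) (ω : RegularPath δ) :
    Tendsto (fun lam => xBif lam δ β τ ω) (𝓝[>] 0) (𝓝 0) := by
  refine (tendsto_inv_setIntegral_weight hβ hβ₀ hbound (l := 𝓝[>] 0) nhdsWithin_le_nhds
    (eventually_mem_nhdsWithin.mono fun c hc => integrableOn_weight_Iic hc ω 0)
    ω.2.lintegral_past τ).congr' ?_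
  filter_upwards [self_mem_nhdsWithin] with c hc using (xBif_of_pos hc τ ω).symm

theorem tendsto_xBif_nhdsLT (hβ : Continuous β) (hβ₀ : 0 < β₀)
    (hbound : ∀ t, β₀ ≤ β t ∧ β t ≤ β₁) (τ : ℝ) (ω : RegularPath δ) :
    Tendsto (fun lam => xBif lam δ β τ ω) (𝓝[<] 0) (𝓝 0) := by
  have := (tendsto_inv_setIntegral_weight hβ hβ₀ hbound (l := 𝓝[<] 0) nhdsWithin_le_nhds
    (eventually_mem_nhdsWithin.mono fun c hc => integrableOn_weight_Ici hc ω 0)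
    ω.2.lintegral_future τ).neg
  rw [neg_zero] at this
  refine this.congr' ?_
  filter_upwards [self_mem_nhdsWithin] with c hc using (xBif_of_neg hc τ ω).symm

end Transcritical

/-! ## Maximal inequality -/

section Maximal

open Finset in
/-- Ottaviani's maximal inequality. -/
theorem iIndepFun_measure_exists_two_mul_le_abs_sum {Ω : Type*} {mΩ : MeasurableSpace Ω}
    {P : Measure Ω} {Y : ℕ → Ω → ℝ} (hY : iIndepFun Y P) (hm : ∀ i, Measurable (Y i))
    {n : ℕ} {a : ℝ} (hG : ∀ k ≤ n, 1 ≤ 2 * P {ω | |∑ i ∈ Finset.Ico k n, Y i ω| ≤ a}) :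
    P {ω | ∃ k ≤ n, 2 * a ≤ |∑ i ∈ range k, Y i ω|} ≤ 2 * P {ω | a ≤ |∑ i ∈ range n, Y i ω|} := by
  set S : ℕ → Ω → ℝ := fun k ω => ∑ i ∈ range k, Y i ω with hS
  -- `A k` is first passage above `2 * a` at step `k` and involves only `Y i` with `i < k`; `G k`,
  -- of probability at least one half, involves only `i ≥ k`. They are independent, and on both the
  -- final sum is at least `a`.
  set A : ℕ → Set Ω := fun k => {ω | (∀ j < k, |S j ω| < 2 * a) ∧ 2 * a ≤ |S k ω|} with hA
  set G : ℕ → Set Ω := fun k => {ω | |∑ i ∈ Finset.Ico k n, Y i ω| ≤ a} with hGdef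
  have hle : ∀ i, MeasurableSpace.comap (Y i) inferInstance ≤ mΩ := fun i => (hm i).comap_le
  have hmeas : ∀ T : Set ℕ, ∀ i ∈ T,
      Measurable[⨆ i ∈ T, MeasurableSpace.comap (Y i) inferInstance] (Y i) := fun T i hi =>
    (comap_measurable (Y i)).mono (le_iSup₂_of_le i hi le_rfl) le_rfl
  have hind : ∀ k ≤ n, P (A k ∩ G k) = P (A k) * P (G k) := by
    intro k hk
    have hdisj : Disjoint (Set.Iio k) (Set.Ici k) :=
      Set.disjoint_left.2 fun i hi hi' => absurd (Set.mem_Iio.1 hi) (not_lt.2 (Set.mem_Ici.1 hi'))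
    refine (Indep_iff _ _ P).1 (indep_iSup_of_disjoint hle hY.iIndep hdisj) _ _ ?_ ?_
    · have hSm : ∀ j ≤ k,
          Measurable[⨆ i ∈ Set.Iio k, MeasurableSpace.comap (Y i) inferInstance] (S j) := by
        intro j hj
        exact Finset.measurable_fun_sum (m := ⨆ i ∈ Set.Iio k, MeasurableSpace.comap (Y i) inferInstance) _
          fun i hi => hmeas _ i ((Finset.mem_range.1 hi).trans_le hj)
      have hrw : A k = (⋂ j ∈ Set.Iio k, S j ⁻¹' {x | |x| < 2 * a}) ∩
          S k ⁻¹' {x | 2 * a ≤ |x|} := by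
        ext ω; simp [hA]
      rw [hrw]
      refine MeasurableSet.inter (MeasurableSet.biInter (Set.to_countable _) fun j hj => ?_) ?_
      · exact hSm j (le_of_lt hj) (measurableSet_lt measurable_norm measurable_const)
      · exact hSm k le_rfl (measurableSet_le measurable_const measurable_norm)
    · have : Measurable[⨆ i ∈ Set.Ici k, MeasurableSpace.comap (Y i) inferInstance]
          (fun ω => ∑ i ∈ Finset.Ico k n, Y i ω) :=
        Finset.measurable_fun_sum (m := ⨆ i ∈ Set.Ici k, MeasurableSpace.comap (Y i) inferInstance) _
          fun i hi => hmeas _ i (Finset.mem_Ico.1 hi).1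
      exact this (measurableSet_le measurable_norm measurable_const)
  have hSm : ∀ k, Measurable (S k) := fun k => Finset.measurable_fun_sum _ fun i _ => hm i
  have hAm : ∀ k, MeasurableSet (A k) := by
    intro k
    have hrw : A k = (⋂ j ∈ Set.Iio k, S j ⁻¹' {x | |x| < 2 * a}) ∩
        S k ⁻¹' {x | 2 * a ≤ |x|} := by
      ext ω; simp [hA]
    rw [hrw]
    refine MeasurableSet.inter (MeasurableSet.biInter (Set.to_countable _) fun j hj => ?_) ?_
    · exact hSm j (measurableSet_lt measurable_norm measurable_const)
    · exact hSm k (measurableSet_le measurable_const measurable_norm)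
  have hGm : ∀ k, MeasurableSet (G k) := fun k =>
    (Finset.measurable_fun_sum _ fun i _ => hm i)
      (measurableSet_le measurable_norm measurable_const)
  have hAdisj : ∀ i j, i < j → Disjoint (A i) (A j) := fun i j hij =>
    Set.disjoint_left.2 fun ω hi hj => absurd (hj.1 i hij) (not_lt.2 hi.2)
  have hcover : {ω | ∃ k ≤ n, 2 * a ≤ |S k ω|} ⊆ ⋃ k ∈ range (n + 1), A k := by
    classical
    rintro ω ⟨k, hk, hka⟩
    have hex : ∃ k, 2 * a ≤ |S k ω| := ⟨k, hka⟩
    refine Set.mem_biUnion (x := Nat.find hex)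
      (Finset.mem_coe.2 (Finset.mem_range_succ_iff.2 ((Nat.find_min' hex hka).trans hk)))
      ⟨fun j hj => not_le.1 (Nat.find_min hex hj), Nat.find_spec hex⟩
  calc P {ω | ∃ k ≤ n, 2 * a ≤ |S k ω|} ≤ ∑ k ∈ range (n + 1), P (A k) :=
        (measure_mono hcover).trans (measure_biUnion_finset_le _ _)
    _ ≤ ∑ k ∈ range (n + 1), 2 * P (A k ∩ G k) := by
        refine Finset.sum_le_sum fun k hk => ?_
        have hk' := Finset.mem_range_succ_iff.1 hk
        rw [hind k hk']
        calc P (A k) = P (A k) * 1 := (mul_one _).symm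
          _ ≤ P (A k) * (2 * P (G k)) := by gcongr; exact hG k hk'
          _ = 2 * (P (A k) * P (G k)) := by ring
    _ = 2 * P (⋃ k ∈ range (n + 1), A k ∩ G k) := by
        rw [← Finset.mul_sum, measure_biUnion_finset _ fun k _ => (hAm k).inter (hGm k)]
        intro i _ j _ hij
        rcases lt_or_gt_of_ne hij with h | h
        · exact (hAdisj i j h).mono Set.inter_subset_left Set.inter_subset_left
        · exact ((hAdisj j i h).mono Set.inter_subset_left Set.inter_subset_left).symm
    _ ≤ 2 * P {ω | a ≤ |S n ω|} := by
        gcongr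
        refine Set.iUnion₂_subset fun k hk ω hω => ?_
        have hk' := Finset.mem_range_succ_iff.1 hk
        have h1 : 2 * a ≤ |S k ω| := hω.1.2
        have h2 : |S n ω - S k ω| ≤ a := by
          have := hω.2
          rwa [hGdef, Set.mem_ofPred_eq, Finset.sum_Ico_eq_sub _ hk'] at this
        have h3 := abs_sub_abs_le_abs_sub (S k ω) (S n ω)
        rw [abs_sub_comm] at h3
        show a ≤ |S n ω|
        linarith

end Maximal

/-! ### Maximal inequality for Brownian motion -/

namespace ProbabilityTheory.IsPreBrownianReal

open scoped NNReal

variable {Ω : Type*} {mΩ : MeasurableSpace Ω} {P : Measure Ω} {B : ℝ≥0 → Ω → ℝ}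

theorem isProbabilityMeasure (hB : IsPreBrownianReal B P) : IsProbabilityMeasure P :=
  hB.isGaussianProcess.isProbabilityMeasure

theorem measure_le_abs_sub_le (hB : IsPreBrownianReal B P) (s t : ℝ≥0) {a : ℝ} (ha : 0 < a) :
    P {ω | a ≤ |B t ω - B s ω|} ≤ ENNReal.ofReal (nndist t s / a ^ 2) := by
  have := hB.isProbabilityMeasure
  have hlaw := hB.hasLaw_sub t s
  have h := meas_ge_le_variance_div_sq (X := B t - B s) (μ := P) hlaw.hasGaussianLaw.memLp_two ha
  rw [hlaw.variance_eq, hlaw.integral_eq, integral_id_gaussianReal, variance_id_gaussianReal] at h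
  simpa [NNReal.dist_eq, Real.dist_eq] using h

theorem measure_le_abs_le (hB : IsPreBrownianReal B P) (h0 : ∀ ω, B 0 ω = 0) (t : ℝ≥0) {a : ℝ}
    (ha : 0 < a) : P {ω | a ≤ |B t ω|} ≤ ENNReal.ofReal (t / a ^ 2) := by
  have := hB.measure_le_abs_sub_le 0 t ha
  simpa [h0, NNReal.nndist_eq] using this

open Finset in
theorem measure_exists_grid_le (hB : IsPreBrownianReal B P) (hm : ∀ t, Measurable (B t))
    (h0 : ∀ ω, B 0 ω = 0) (t : ℕ → ℝ≥0) (ht : Monotone t) (ht0 : t 0 = 0) (n : ℕ) {a : ℝ}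
    (ha : 0 < a) :
    P {ω | ∃ k ≤ n, 2 * a ≤ |B (t k) ω|} ≤ ENNReal.ofReal (2 * t n / a ^ 2) := by
  have := hB.isProbabilityMeasure
  -- In the first case the claimed bound is at least `1`. In the second, Chebyshev gives the
  -- probability one half needed in Ottaviani's inequality.
  rcases le_or_gt (a ^ 2) (2 * t n) with hT | hT
  · refine prob_le_one.trans ?_
    rw [← ENNReal.ofReal_one]
    exact ENNReal.ofReal_le_ofReal ((one_le_div (by positivity)).2 hT)
  have hsum : ∀ k ω, ∑ i ∈ range k, (B (t (i + 1)) ω - B (t i) ω) = B (t k) ω := fun k ω => by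
    rw [Finset.sum_range_sub (fun i => B (t i) ω), ht0, h0, sub_zero]
  have key := iIndepFun_measure_exists_two_mul_le_abs_sum (hB.hasIndepIncrements.nat ht)
    (fun i => (hm _).sub (hm _)) (n := n) (a := a) (fun k hk => by
      have hrw : ∀ ω, ∑ i ∈ Finset.Ico k n, (B (t (i + 1)) ω - B (t i) ω) =
          B (t n) ω - B (t k) ω := fun ω => by
        rw [Finset.sum_Ico_eq_sub _ hk, hsum, hsum]
      simp only [hrw]
      have hle : P {ω | |B (t n) ω - B (t k) ω| ≤ a}ᶜ ≤ 2⁻¹ := by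
        refine (measure_mono fun ω hω => ?_).trans
          ((hB.measure_le_abs_sub_le (t k) (t n) ha).trans ?_)
        · exact (not_le.1 (show ¬ |B (t n) ω - B (t k) ω| ≤ a from hω)).le
        · rw [← ENNReal.ofReal_ofNat, ← ENNReal.ofReal_inv_of_pos two_pos]
          refine ENNReal.ofReal_le_ofReal ?_
          rw [div_le_iff₀ (by positivity)]
          have h1 : ((nndist (t n) (t k) : ℝ≥0) : ℝ) ≤ t n := by
            rw [coe_nndist, NNReal.dist_eq, abs_of_nonneg (sub_nonneg.2 (by exact_mod_cast ht hk))]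
            have := (t k).coe_nonneg
            linarith
          linarith
      have hms : MeasurableSet {ω | |B (t n) ω - B (t k) ω| ≤ a} :=
        ((hm _).sub (hm _)) (measurableSet_le measurable_norm measurable_const)
      have hadd := prob_add_prob_compl (μ := P) hms
      have h2 : (2⁻¹ : ℝ≥0∞) + 2⁻¹ ≤ P {ω | |B (t n) ω - B (t k) ω| ≤ a} + 2⁻¹ := by
        rw [ENNReal.inv_two_add_inv_two, ← hadd]
        gcongr
      have h3 := (ENNReal.add_le_add_iff_right (by simp)).1 h2
      calc (1 : ℝ≥0∞) = 2 * 2⁻¹ := (ENNReal.mul_inv_cancel (by simp) (by simp)).symm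
        _ ≤ _ := by gcongr)
  simp only [hsum] at key
  refine key.trans ((mul_le_mul_right (hB.measure_le_abs_le h0 (t n) ha) 2).trans_eq ?_)
  rw [← ENNReal.ofReal_ofNat, ← ENNReal.ofReal_mul (by norm_num), mul_div_assoc]

/-- Dyadic grids are nested, so the grid events increase and their common bound passes to the union.
By continuity a strict exceedance is already seen at some dyadic point. -/
theorem measure_exists_le_lt_abs_le (hB : IsPreBrownianReal B P) (hm : ∀ t, Measurable (B t))
    (h0 : ∀ ω, B 0 ω = 0) (hc : ∀ ω, Continuous (B · ω)) (T : ℝ≥0) {a : ℝ} (ha : 0 < a) :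
    P {ω | ∃ s ≤ T, 2 * a < |B s ω|} ≤ ENNReal.ofReal (2 * T / a ^ 2) := by
  set E : ℕ → Set Ω := fun m => {ω | ∃ k : ℕ, k ≤ 2 ^ m ∧ 2 * a ≤ |B (T * (k / 2 ^ m)) ω|} with hE
  have hmono : Monotone E := monotone_nat_of_le_succ fun m ω => by
    rintro ⟨k, hk, h⟩
    refine ⟨2 * k, by rw [pow_succ]; omega, ?_⟩
    have : ((2 * k : ℕ) : ℝ≥0) / 2 ^ (m + 1) = k / 2 ^ m := by
      push_cast; rw [pow_succ]; field_simp
    rwa [this]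
  have hbd : ∀ m, P (E m) ≤ ENNReal.ofReal (2 * T / a ^ 2) := fun m => by
    have := hB.measure_exists_grid_le hm h0 (fun k => T * (k / 2 ^ m))
      (fun i j hij => by dsimp only; gcongr) (by simp) (2 ^ m) ha
    simpa using this
  have hcover : {ω | ∃ s ≤ T, 2 * a < |B s ω|} ⊆ ⋃ m, E m := by
    rintro ω ⟨s, hs, hsa⟩
    have hT : T ≠ 0 := by
      rintro rfl
      obtain rfl := le_antisymm hs zero_le
      rw [h0, abs_zero] at hsa
      linarith
    set u : ℝ≥0 := s / T
    have hu1 : u ≤ 1 := div_le_one_of_le₀ hs zero_le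
    have hTu : T * u = s := mul_div_cancel₀ s hT
    have hlim : Tendsto (fun m : ℕ => ((⌊(u : ℝ) * 2 ^ m⌋₊ : ℝ≥0) / 2 ^ m : ℝ≥0)) atTop (𝓝 u) := by
      rw [← NNReal.tendsto_coe]
      have h1 := (tendsto_nat_floor_mul_div_atTop (R := ℝ) u.coe_nonneg).comp
        (tendsto_pow_atTop_atTop_of_one_lt (one_lt_two (α := ℝ)))
      simpa [Function.comp_def] using h1
    have hlim2 : Tendsto (fun m : ℕ => |B (T * ((⌊(u : ℝ) * 2 ^ m⌋₊ : ℝ≥0) / 2 ^ m)) ω|) atTop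
        (𝓝 |B s ω|) := by
      rw [← hTu]
      exact (((hc ω).tendsto _).comp (hlim.const_mul T)).abs
    obtain ⟨m, hm⟩ := (hlim2.eventually (lt_mem_nhds hsa)).exists
    refine Set.mem_iUnion.2 ⟨m, ⌊(u : ℝ) * 2 ^ m⌋₊, ?_, hm.le⟩
    refine Nat.floor_le_of_le ?_
    push_cast
    exact mul_le_of_le_one_left (by positivity) hu1
  refine (measure_mono hcover).trans ?_
  rw [hmono.measure_iUnion]
  exact iSup_le hbd

end ProbabilityTheory.IsPreBrownianReal

/-! ## Almost sure behaviour of Brownian paths -/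

theorem ENNReal.tsum_ofReal_const_mul_pow_ne_top (C : ℝ) {r : ℝ} (hr0 : 0 ≤ r) (hr1 : r < 1) :
    ∑' n : ℕ, ENNReal.ofReal (C * r ^ n) ≠ ∞ :=
  ((summable_geometric_of_lt_one hr0 hr1).mul_left C).tsum_ofReal_ne_top

theorem setLIntegral_Ici_eq_top_of_frequently {f : ℝ → ℝ≥0∞} {σ : ℕ → ℝ} (hσ0 : ∀ n, 0 ≤ σ n)
    (hσ : ∀ n, σ n + 1 ≤ σ (n + 1))
    (h : ∃ᶠ n in atTop, ∀ s ∈ Ioc (σ n) (σ n + 1), 1 ≤ f s) :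
    ∫⁻ s in Ici (0 : ℝ), f s = ∞ := by
  have hmono : Monotone σ := monotone_nat_of_le_succ fun n => by linarith [hσ n]
  set I : Set ℕ := {n | ∀ s ∈ Ioc (σ n) (σ n + 1), 1 ≤ f s} with hI
  have hinf : Infinite I := (Nat.frequently_atTop_iff_infinite.1 h).to_subtype
  have hdisj' : ∀ m n, m < n → Disjoint (Ioc (σ m) (σ m + 1)) (Ioc (σ n) (σ n + 1)) :=
    fun m n hmn => Ioc_disjoint_Ioc_of_le ((hσ m).trans (hmono hmn))
  have hdisj : Pairwise (Function.onFun Disjoint fun n : I => Ioc (σ n) (σ n + 1)) := by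
    intro m n hmn
    rcases lt_or_gt_of_ne (Subtype.coe_ne_coe.2 hmn) with h | h
    · exact hdisj' _ _ h
    · exact (hdisj' _ _ h).symm
  have hsub : (⋃ n : I, Ioc (σ n) (σ n + 1)) ⊆ Ici 0 :=
    iUnion_subset fun n s hs => (hσ0 n).trans hs.1.le
  refine top_le_iff.1 (le_trans ?_ (lintegral_mono_set hsub))
  rw [lintegral_iUnion (fun _ => measurableSet_Ioc) hdisj,
    ← ENNReal.tsum_const_eq_top_of_ne_zero (α := I) one_ne_zero]
  refine ENNReal.tsum_le_tsum fun n => ?_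
  calc (1 : ℝ≥0∞) = ∫⁻ _ in Ioc (σ n) (σ n + 1), 1 := by simp
    _ ≤ _ := setLIntegral_mono' measurableSet_Ioc n.2

namespace ProbabilityTheory.IsPreBrownianReal

open scoped NNReal

variable {Ω : Type*} {mΩ : MeasurableSpace Ω} {P : Measure Ω} {B : ℝ≥0 → Ω → ℝ}

/-- The maximal inequality on `[0, 2 ^ (n + 1)]` with `a = ε * 2 ^ n / 2` gives exceptional
probability `16 / ε ^ 2 * 2⁻ⁿ`, summable, so Borel–Cantelli applies. -/
theorem ae_eventually_dyadic_le (hB : IsPreBrownianReal B P) (hm : ∀ t, Measurable (B t))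
    (h0 : ∀ ω, B 0 ω = 0) (hc : ∀ ω, Continuous (B · ω)) {ε : ℝ} (hε : 0 < ε) :
    ∀ᵐ ω ∂P, ∀ᶠ n : ℕ in atTop, ∀ s ≤ (2 : ℝ≥0) ^ (n + 1), |B s ω| ≤ ε * 2 ^ n := by
  have hsum : ∑' n : ℕ, P {ω | ∃ s ≤ (2 : ℝ≥0) ^ (n + 1), 2 * (ε * 2 ^ n / 2) < |B s ω|} ≠ ∞ := by
    refine ne_top_of_le_ne_top (ENNReal.tsum_ofReal_const_mul_pow_ne_top (16 / ε ^ 2)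
      (r := 1 / 2) (by norm_num) (by norm_num)) (ENNReal.tsum_le_tsum fun n => ?_)
    refine (hB.measure_exists_le_lt_abs_le hm h0 hc _ (by positivity)).trans
      (ENNReal.ofReal_le_ofReal (le_of_eq ?_))
    push_cast
    rw [pow_succ, one_div, inv_pow]
    field_simp
    norm_num
  filter_upwards [ae_eventually_notMem hsum] with ω hω
  filter_upwards [hω] with n hn s hs
  by_contra hcon
  exact hn ⟨s, hs, by rw [mul_div_cancel₀ _ (two_ne_zero)]; exact not_le.1 hcon⟩

theorem ae_tendsto_div_atTop (hB : IsPreBrownianReal B P) (hm : ∀ t, Measurable (B t))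
    (h0 : ∀ ω, B 0 ω = 0) (hc : ∀ ω, Continuous (B · ω)) :
    ∀ᵐ ω ∂P, Tendsto (fun t : ℝ => B t.toNNReal ω / t) atTop (𝓝 0) := by
  have hall : ∀ᵐ ω ∂P, ∀ j : ℕ, ∀ᶠ n : ℕ in atTop, ∀ s ≤ (2 : ℝ≥0) ^ (n + 1),
      |B s ω| ≤ 1 / ((j : ℝ) + 1) * 2 ^ n :=
    ae_all_iff.2 fun j => hB.ae_eventually_dyadic_le hm h0 hc (by positivity)
  filter_upwards [hall] with ω hω
  rw [Metric.tendsto_nhds]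
  intro ε hε
  obtain ⟨j, hj⟩ := exists_nat_one_div_lt hε
  obtain ⟨N, hN⟩ := eventually_atTop.1 (hω j)
  filter_upwards [eventually_ge_atTop ((2 : ℝ) ^ N)] with t ht
  have ht1 : 1 ≤ t := (one_le_pow₀ one_le_two).trans ht
  obtain ⟨n, hn1, hn2⟩ := exists_nat_pow_near ht1 (one_lt_two (α := ℝ))
  have hNn : N ≤ n := by
    by_contra hcon
    have h1 : (2 : ℝ) ^ (n + 1) ≤ 2 ^ N := pow_le_pow_right₀ one_le_two (not_le.1 hcon)
    linarith
  have hb := hN n hNn t.toNNReal (by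
    rw [Real.toNNReal_le_iff_le_coe]; push_cast; exact hn2.le)
  have ht0 : 0 < t := one_pos.trans_le ht1
  rw [Real.dist_0_eq_abs, abs_div, abs_of_pos ht0, div_lt_iff₀ ht0]
  calc _ ≤ 1 / ((j : ℝ) + 1) * 2 ^ n := hb
    _ ≤ 1 / ((j : ℝ) + 1) * t := by gcongr
    _ < ε * t := by gcongr

/-- Brownian scaling: an increment exceeds its own standard deviation with a probability independent
of the interval, so such events are not summable. -/
theorem measure_sqrt_le_sub (hB : IsPreBrownianReal B P) {s t : ℝ≥0} (hst : s < t) :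
    P {ω | √(t - s : ℝ) ≤ B t ω - B s ω} = gaussianReal 0 1 (Ici 1) := by
  have hd : 0 < (t : ℝ) - s := sub_pos.2 (by exact_mod_cast hst)
  have hlaw := gaussianReal_div_const (hB.hasLaw_sub t s) √(t - s : ℝ)
  have hv : nndist (t : ℝ) s / NNReal.mk (√(t - s : ℝ) ^ 2) (sq_nonneg _) = 1 := by
    rw [← NNReal.coe_inj, NNReal.coe_div, coe_nndist, Real.dist_eq, abs_of_pos hd]
    simp only [NNReal.coe_mk, NNReal.coe_one]
    rw [Real.sq_sqrt hd.le, div_self hd.ne']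
  have hlaw' : HasLaw (fun ω => (B t - B s) ω / √(t - s : ℝ)) (gaussianReal 0 1) P := by
    rw [← hv]; simpa using hlaw
  have := hlaw'.measure_eq (p := fun x => 1 ≤ x) measurableSet_Ici
  rw [show Ici (1 : ℝ) = {x | 1 ≤ x} from rfl, ← this]
  congr 1
  ext ω
  simp only [mem_ofPred_eq, Pi.sub_apply]
  rw [one_le_div (Real.sqrt_pos.2 hd)]

theorem gaussianReal_Ici_ne_zero : gaussianReal 0 1 (Ici 1) ≠ 0 := fun h => by
  have := gaussianReal_absolutelyContinuous' 0 (v := 1) one_ne_zero h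
  simp at this

theorem ae_frequently_sqrt_le_sub (hB : IsPreBrownianReal B P) (hm : ∀ t, Measurable (B t))
    {t : ℕ → ℝ≥0} (ht : StrictMono t) :
    ∀ᵐ ω ∂P, ∃ᶠ n in atTop, √(t (n + 1) - t n : ℝ) ≤ B (t (n + 1)) ω - B (t n) ω := by
  have := hB.isProbabilityMeasure
  set E : ℕ → Set Ω := fun n => {ω | √(t (n + 1) - t n : ℝ) ≤ B (t (n + 1)) ω - B (t n) ω} with hE
  have hEm : ∀ n, MeasurableSet (E n) := fun n =>
    measurableSet_le measurable_const ((hm _).sub (hm _))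
  have hind : iIndepSet E P := by
    rw [iIndepSet_iff_meas_biInter hEm]
    intro s
    exact (hB.hasIndepIncrements.nat ht.monotone).measure_inter_preimage_eq_mul (S := s)
      (sets := fun n => Ici √(t (n + 1) - t n : ℝ)) fun _ _ => measurableSet_Ici
  have hlim := measure_limsup_eq_one hEm hind (by
    simp only [hE, fun n => hB.measure_sqrt_le_sub (ht (Nat.lt_succ_self n))]
    exact ENNReal.tsum_const_eq_top_of_ne_zero gaussianReal_Ici_ne_zero)
  have := (mem_ae_iff_prob_eq_one (MeasurableSet.measurableSet_limsup hEm)).2 hlim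
  filter_upwards [this] with ω hω
  exact mem_limsup_iff_frequently_mem.1 hω

/-- Along `t n = 2 ^ n ^ 2` each gap exceeds the whole past by a factor `4 ^ n`. Infinitely often
the increment over the gap is at least the root of its length, by the second Borel–Cantelli lemma.
Eventually `|B (t n)|` is below half of that root, and the oscillation on the unit interval after `t
(n + 1)` is at most the other half. Hence `B` is nonnegative on infinitely many disjoint unit
intervals, each contributing at least `1`. -/
theorem ae_lintegral_exp_eq_top (hB : IsPreBrownianReal B P) (hm : ∀ t, Measurable (B t))
    (h0 : ∀ ω, B 0 ω = 0) (hc : ∀ ω, Continuous (B · ω)) {δ : ℝ} (hδ : 0 ≤ δ) :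
    ∀ᵐ ω ∂P, ∫⁻ s in Ici (0 : ℝ), ENNReal.ofReal (Real.exp (δ * B s.toNNReal ω)) = ∞ := by
  set t : ℕ → ℝ≥0 := fun n => 2 ^ (n ^ 2) with ht_def
  have ht1 : ∀ n, (1 : ℝ) ≤ t n := fun n => by
    have : (1 : ℝ≥0) ≤ t n := one_le_pow₀ one_le_two
    exact_mod_cast this
  have hstep : ∀ n, (t (n + 1) : ℝ) = t n * (2 * 4 ^ n) := fun n => by
    simp only [ht_def]
    push_cast
    rw [show (4 : ℝ) = 2 ^ 2 by norm_num, ← pow_mul, ← pow_succ', ← pow_add]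
    congr 1
    ring
  have h4 : ∀ n : ℕ, (1 : ℝ) ≤ 4 ^ n := fun n => one_le_pow₀ (by norm_num)
  have hgap : ∀ n, (t n : ℝ) * 4 ^ n ≤ t (n + 1) - t n := fun n => by
    rw [hstep]; nlinarith [ht1 n, h4 n]
  have hgap4 : ∀ n, (4 : ℝ) ^ n ≤ t (n + 1) - t n := fun n =>
    (le_mul_of_one_le_left (by positivity) (ht1 n)).trans (hgap n)
  have hmono : StrictMono t := strictMono_nat_of_lt_succ fun n => by
    have : (t n : ℝ) < t (n + 1) := by linarith [hgap4 n, h4 n]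
    exact_mod_cast this
  have hsqrt : ∀ n, (2 : ℝ) ^ n ≤ √(t (n + 1) - t n : ℝ) := fun n => by
    refine Real.le_sqrt_of_sq_le ?_
    rw [← pow_mul, mul_comm, pow_mul]
    norm_num
    exact hgap4 n
  have hF : ∀ᵐ ω ∂P, ∀ᶠ n in atTop, |B (t n) ω| < √(t (n + 1) - t n : ℝ) / 2 := by
    have hsum : ∑' n : ℕ, P {ω | √(t (n + 1) - t n : ℝ) / 2 ≤ |B (t n) ω|} ≠ ∞ := by
      refine ne_top_of_le_ne_top (ENNReal.tsum_ofReal_const_mul_pow_ne_top 4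
        (r := 1 / 4) (by norm_num) (by norm_num)) (ENNReal.tsum_le_tsum fun n => ?_)
      have hpos : (0 : ℝ) < t (n + 1) - t n := by linarith [hgap4 n, h4 n]
      refine (hB.measure_le_abs_le h0 _ (half_pos (Real.sqrt_pos.2 hpos))).trans
        (ENNReal.ofReal_le_ofReal ?_)
      rw [div_pow, Real.sq_sqrt hpos.le, one_div, inv_pow, ← div_eq_mul_inv,
        div_le_div_iff₀ (by positivity) (by positivity)]
      linarith [hgap n]
    filter_upwards [ae_eventually_notMem hsum] with ω hω
    exact hω.mono fun n hn => not_le.1 hn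
  have hG : ∀ᵐ ω ∂P, ∀ᶠ n : ℕ in atTop, ∀ s ≤ (1 : ℝ≥0),
      |B (t (n + 1) + s) ω - B (t (n + 1)) ω| ≤ 2 ^ n / 2 := by
    have hsum : ∑' n : ℕ, P {ω | ∃ s ≤ (1 : ℝ≥0),
        2 * ((2 : ℝ) ^ n / 4) < |B (t (n + 1) + s) ω - B (t (n + 1)) ω|} ≠ ∞ := by
      refine ne_top_of_le_ne_top (ENNReal.tsum_ofReal_const_mul_pow_ne_top 32
        (r := 1 / 4) (by norm_num) (by norm_num)) (ENNReal.tsum_le_tsum fun n => ?_)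
      refine ((hB.shift (t (n + 1))).measure_exists_le_lt_abs_le (fun s => (hm _).sub (hm _))
        (by simp) (fun ω => ?_) 1 (by positivity)).trans (ENNReal.ofReal_le_ofReal (le_of_eq ?_))
      · have := hc ω
        fun_prop
      · rw [div_pow, ← pow_mul, mul_comm n 2, pow_mul, one_div, inv_pow]
        norm_num
        field_simp
        norm_num
    filter_upwards [ae_eventually_notMem hsum] with ω hω
    filter_upwards [hω] with n hn s hs
    by_contra hcon
    exact hn ⟨s, hs, by linarith [not_le.1 hcon]⟩
  filter_upwards [hB.ae_frequently_sqrt_le_sub hm hmono, hF, hG] with ω hE hF hG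
  refine setLIntegral_Ici_eq_top_of_frequently (σ := fun n => (t (n + 1) : ℝ))
    (fun n => NNReal.coe_nonneg _) (fun n => by linarith [hgap4 (n + 1), h4 (n + 1)])
    ((hE.and_eventually (hF.and hG)).mono fun n hn s hs => ?_)
  obtain ⟨hn1, hn2, hn3⟩ := hn
  have hs0 : 0 ≤ s - t (n + 1) := by linarith [hs.1]
  have h1 := hn3 (s - t (n + 1)).toNNReal (by
    rw [Real.toNNReal_le_iff_le_coe, NNReal.coe_one]; linarith [hs.2])
  have h2 : t (n + 1) + (s - t (n + 1)).toNNReal = s.toNNReal := by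
    rw [← NNReal.coe_inj]
    push_cast
    rw [Real.coe_toNNReal _ hs0, Real.coe_toNNReal _ ((NNReal.coe_nonneg _).trans hs.1.le)]
    ring
  rw [h2] at h1
  have h3 := hsqrt n
  have h4 := abs_lt.1 hn2
  have h5 := abs_le.1 h1
  have h6 : 0 ≤ B s.toNNReal ω := by linarith
  rw [ENNReal.one_le_ofReal, Real.one_le_exp_iff]
  exact mul_nonneg hδ h6

end ProbabilityTheory.IsPreBrownianReal

/-! ## Wiener measure is carried by the regular paths -/

namespace IsWienerMeasure

open scoped NNReal

variable {P : Measure WienerPath}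

theorem isPreBrownianReal (hP : IsWienerMeasure P) :
    IsPreBrownianReal (fun (t : ℝ≥0) (ω : WienerPath) => ω t) P := by
  refine HasIndepIncrements.isPreBrownianReal_of_hasLaw (fun t => ?_) fun n t ht => ?_
  · have := hP.hasLaw_sub 0 t t.coe_nonneg
    simpa [WienerPath.map_zero] using this
  · exact hP.hasIndepIncrements n (fun i => (t i : ℝ)) fun i j hij => by exact_mod_cast ht hij

theorem isPreBrownianReal_neg (hP : IsWienerMeasure P) :
    IsPreBrownianReal (fun (t : ℝ≥0) (ω : WienerPath) => ω (-t)) P := by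
  refine HasIndepIncrements.isPreBrownianReal_of_hasLaw (fun t => ?_) fun n t ht => ?_
  · have := gaussianReal_neg (hP.hasLaw_sub (-t) 0 (by simp))
    simpa [WienerPath.map_zero, Pi.neg_def] using this
  -- Negating times reverses their order; `Fin.rev` restores it, at the price of a sign on each
  -- increment.
  · have h := hP.hasIndepIncrements n (fun i => -(t i.rev : ℝ)) fun i j hij => by
      have := ht (Fin.rev_le_rev.2 hij)
      simpa using this
    have h2 := (h.precomp Fin.rev_injective).comp (fun _ x => -x) fun _ => measurable_neg
    refine (iIndepFun_congr fun i => ?_).1 h2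
    refine Eventually.of_forall fun ω => ?_
    simp [Fin.rev_succ, Fin.rev_castSucc]

theorem ae_isRegularPath (hP : IsWienerMeasure P) {δ : ℝ} (hδ : 0 ≤ δ) :
    ∀ᵐ ω ∂P, IsRegularPath δ ω := by
  have hc1 : ∀ ω : WienerPath, Continuous fun t : ℝ≥0 => ω t := fun ω =>
    ω.continuous.comp NNReal.continuous_coe
  have hc2 : ∀ ω : WienerPath, Continuous fun t : ℝ≥0 => ω (-t) := fun ω =>
    ω.continuous.comp (NNReal.continuous_coe.neg)
  have m1 : ∀ t : ℝ≥0, Measurable fun ω : WienerPath => ω t := fun t =>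
    Transcritical.measurable_eval _
  have m2 : ∀ t : ℝ≥0, Measurable fun ω : WienerPath => ω (-t) := fun t =>
    Transcritical.measurable_eval _
  have z1 : ∀ ω : WienerPath, ω ((0 : ℝ≥0) : ℝ) = 0 := fun ω => ω.map_zero
  have z2 : ∀ ω : WienerPath, ω (-((0 : ℝ≥0) : ℝ)) = 0 := fun ω => by simp [ω.map_zero]
  filter_upwards [hP.isPreBrownianReal.ae_tendsto_div_atTop m1 z1 hc1,
    hP.isPreBrownianReal_neg.ae_tendsto_div_atTop m2 z2 hc2,
    hP.isPreBrownianReal.ae_lintegral_exp_eq_top m1 z1 hc1 hδ,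
    hP.isPreBrownianReal_neg.ae_lintegral_exp_eq_top m2 z2 hc2 hδ] with ω h1 h2 h3 h4
  refine ⟨h1.congr' ?_, ?_, ?_, ?_⟩
  · filter_upwards [eventually_ge_atTop 0] with t ht
    rw [Real.coe_toNNReal _ ht]
  · have h5 := (h2.comp tendsto_neg_atBot_atTop).neg
    rw [neg_zero] at h5
    refine h5.congr' ?_
    filter_upwards [eventually_le_atBot 0] with t ht
    simp only [Function.comp_apply]
    rw [Real.coe_toNNReal _ (neg_nonneg.2 (mem_Iic.1 ht)), neg_neg, div_neg, neg_neg]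
  · rw [← h4, ← (Measure.measurePreserving_neg (volume : Measure ℝ)).setLIntegral_comp_preimage_emb
      (MeasurableEquiv.neg ℝ).measurableEmbedding]
    rw [show (Neg.neg ⁻¹' Iic (0 : ℝ)) = Ici 0 by ext; simp]
    refine setLIntegral_congr_fun measurableSet_Ici fun s hs => ?_
    simp only [Real.coe_toNNReal _ (mem_Ici.1 hs)]
  · rw [← h3]
    refine setLIntegral_congr_fun measurableSet_Ici fun s hs => ?_
    simp only [Real.coe_toNNReal _ (mem_Ici.1 hs)]

end IsWienerMeasure

/-! ## Trapezoidal sums along a path with bounded quadratic variation -/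

section Trapezoid

/-- The trapezoidal rule is exact through second order, so the error is cubic. This is where the
Stratonovich choice matters: no second-order correction survives. -/
theorem abs_trapezoid_exp_sub_le {x y : ℝ} (h : |y - x| ≤ 1) :
    |(Real.exp x + Real.exp y) / 2 * (y - x) - (Real.exp y - Real.exp x)| ≤
      Real.exp x * |y - x| ^ 3 := by
  set z := y - x with hz
  have hy : Real.exp y = Real.exp x * Real.exp z := by rw [← Real.exp_add]; congr 1; ring
  have h2 : |Real.exp z - (1 + z)| ≤ |z| ^ 2 * (3 / 4) := by
    have := Real.exp_bound h (n := 2) (by norm_num)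
    norm_num [Finset.sum_range_succ, Nat.factorial] at this ⊢
    linarith
  have h3 : |Real.exp z - (1 + z + z ^ 2 / 2)| ≤ |z| ^ 3 * (2 / 9) := by
    have := Real.exp_bound h (n := 3) (by norm_num)
    norm_num [Finset.sum_range_succ, Nat.factorial] at this ⊢
    linarith
  have e : (Real.exp x + Real.exp y) / 2 * z - (Real.exp y - Real.exp x) =
      Real.exp x * (z * (Real.exp z - (1 + z)) / 2 - (Real.exp z - (1 + z + z ^ 2 / 2))) := by
    rw [hy]; ring
  rw [e, abs_mul, abs_of_pos (Real.exp_pos x)]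
  refine mul_le_mul_of_nonneg_left ?_ (Real.exp_pos x).le
  have h4 : |z * (Real.exp z - (1 + z)) / 2| ≤ |z| * (|z| ^ 2 * (3 / 4)) / 2 := by
    rw [abs_div, abs_mul, abs_of_pos (two_pos (α := ℝ))]
    gcongr
  have h5 : 0 ≤ |z| ^ 3 := by positivity
  calc _ ≤ |z * (Real.exp z - (1 + z)) / 2| + |Real.exp z - (1 + z + z ^ 2 / 2)| := abs_sub _ _
    _ ≤ |z| * (|z| ^ 2 * (3 / 4)) / 2 + |z| ^ 3 * (2 / 9) := add_le_add h4 h3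
    _ ≤ |z| ^ 3 := by nlinarith

variable {w A A' : ℝ → ℝ} {δ a b : ℝ}

/-- The error of one trapezoidal step for the integral of `δ A exp(δ w)` against `w`. -/
theorem abs_trapezoid_step_le (hw : Continuous w)
    (hA : ∀ s ∈ Icc a b, HasDerivAt A (A' s) s) (hA' : ContinuousOn A' (Icc a b))
    {C : ℝ} (hC : 0 ≤ C) (hAC : ∀ s ∈ Icc a b, |A s| ≤ C) (hA'C : ∀ s ∈ Icc a b, |A' s| ≤ C)
    (hEC : ∀ s ∈ Icc a b, Real.exp (δ * w s) ≤ C) {u v κ : ℝ} (hu : u ∈ Icc a b) (hv : v ∈ Icc a b)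
    (huv : u ≤ v) (hκ1 : κ ≤ 1) (hwκ : |δ * w v - δ * w u| ≤ κ)
    (hEκ : ∀ r ∈ Icc u v, |Real.exp (δ * w r) - Real.exp (δ * w v)| ≤ κ) :
    |(δ * (A u * Real.exp (δ * w u)) + δ * (A v * Real.exp (δ * w v))) / 2 * (w v - w u) -
        (A v * Real.exp (δ * w v) - A u * Real.exp (δ * w u)) +
        ∫ r in u..v, A' r * Real.exp (δ * w r)| ≤
      C * C * δ ^ 2 * κ * (w v - w u) ^ 2 + (C * C + C) * κ * (v - u) := by
  have hsub : Icc u v ⊆ Icc a b := Icc_subset_Icc hu.1 hv.2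
  have huIcc : uIcc u v = Icc u v := uIcc_of_le huv
  have hκ0 : 0 ≤ κ := (abs_nonneg _).trans hwκ
  have hi1 : IntervalIntegrable A' volume u v :=
    (hA'.mono (huIcc ▸ hsub)).intervalIntegrable
  have hi2 : IntervalIntegrable (fun r => A' r * Real.exp (δ * w r)) volume u v :=
    ((hA'.mono (huIcc ▸ hsub)).mul (by fun_prop)).intervalIntegrable
  have hFTC : ∫ r in u..v, A' r = A v - A u :=
    intervalIntegral.integral_eq_sub_of_hasDerivAt
      (fun x hx => hA x (hsub (huIcc ▸ hx))) hi1
  have hdA : |A v - A u| ≤ C * (v - u) := by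
    rw [← hFTC, ← abs_of_nonneg (sub_nonneg.2 huv), ← Real.norm_eq_abs (intervalIntegral _ _ _ _)]
    exact intervalIntegral.norm_integral_le_of_norm_le_const fun x hx =>
      hA'C x (hsub (Ioc_subset_Icc_self (uIoc_of_le huv ▸ hx)))
  have hI : |∫ r in u..v, A' r * (Real.exp (δ * w r) - Real.exp (δ * w v))| ≤
      C * κ * (v - u) := by
    rw [← abs_of_nonneg (sub_nonneg.2 huv), ← Real.norm_eq_abs (intervalIntegral _ _ _ _)]
    refine intervalIntegral.norm_integral_le_of_norm_le_const fun x hx => ?_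
    have hx' : x ∈ Icc u v := Ioc_subset_Icc_self (uIoc_of_le huv ▸ hx)
    rw [norm_mul]
    exact mul_le_mul (hA'C x (hsub hx')) (hEκ x hx') (abs_nonneg _) hC
  have hIeq : ∫ r in u..v, A' r * (Real.exp (δ * w r) - Real.exp (δ * w v)) =
      (∫ r in u..v, A' r * Real.exp (δ * w r)) - (A v - A u) * Real.exp (δ * w v) := by
    simp only [mul_sub]
    rw [intervalIntegral.integral_sub hi2 (hi1.mul_const _), intervalIntegral.integral_mul_const,
      hFTC]
  have hT := abs_trapezoid_exp_sub_le (hwκ.trans hκ1)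
  set Eu := Real.exp (δ * w u)
  set Ev := Real.exp (δ * w v)
  have hT2 : |A u * ((Eu + Ev) / 2 * (δ * w v - δ * w u) - (Ev - Eu))| ≤
      C * C * δ ^ 2 * κ * (w v - w u) ^ 2 := by
    rw [abs_mul]
    calc |A u| * |(Eu + Ev) / 2 * (δ * w v - δ * w u) - (Ev - Eu)|
        ≤ C * (Eu * |δ * w v - δ * w u| ^ 3) :=
          mul_le_mul (hAC u hu) hT (abs_nonneg _) hC
      _ ≤ C * (C * (κ * |δ * w v - δ * w u| ^ 2)) := by
          gcongr
          · exact hEC u hu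
          · rw [pow_succ, mul_comm]; gcongr
      _ = _ := by rw [sq_abs]; ring
  have hM : |(A v - A u) * Ev * (δ * w v - δ * w u) / 2| ≤ C * C * κ * (v - u) := by
    rw [abs_div, abs_mul, abs_mul, abs_of_pos (two_pos (α := ℝ)),
      abs_of_pos (Real.exp_pos _ : 0 < Ev)]
    have : |A v - A u| * Ev * |δ * w v - δ * w u| ≤ C * (v - u) * C * κ := by
      have h0 : 0 ≤ C * (v - u) := mul_nonneg hC (sub_nonneg.2 huv)
      gcongr
      exact hEC v hv
    have h0 : 0 ≤ |A v - A u| * Ev * |δ * w v - δ * w u| := by positivity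
    nlinarith
  -- Three errors: the exponential trapezoid with amplitude frozen at `u`, the cross term of the two
  -- increments, and the drift with the exponential frozen at `v`.
  have hsplit : (δ * (A u * Eu) + δ * (A v * Ev)) / 2 * (w v - w u) - (A v * Ev - A u * Eu) +
      ∫ r in u..v, A' r * Real.exp (δ * w r) =
      A u * ((Eu + Ev) / 2 * (δ * w v - δ * w u) - (Ev - Eu)) +
      (A v - A u) * Ev * (δ * w v - δ * w u) / 2 +
      ∫ r in u..v, A' r * (Real.exp (δ * w r) - Ev) := by
    rw [hIeq]; ring
  rw [hsplit]
  refine (abs_add_three _ _ _).trans ?_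
  linarith

/-- Uniform continuity of the path makes the factor `κ` in the one-step error small with the mesh.
The squared increments are only assumed bounded for the given `n`, because along arbitrary
partitions they are controlled in probability and not path by path. -/
theorem eventually_abs_trapezoid_sum_le (hab : a ≤ b) (hw : Continuous w)
    (hA : ∀ s ∈ Icc a b, HasDerivAt A (A' s) s) (hA' : ContinuousOn A' (Icc a b))
    {N : ℕ → ℕ} {s : ℕ → ℕ → ℝ} (hs : ∀ n, Monotone (s n) ∧ s n 0 = a ∧ s n (N n) = b)
    (hmesh : ∀ η > 0, ∀ᶠ n in atTop, ∀ i < N n, s n (i + 1) - s n i < η) {ε M : ℝ} (hε : 0 < ε)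
    (hM : 0 ≤ M) :
    ∀ᶠ n in atTop, ∑ i ∈ Finset.range (N n), (w (s n (i + 1)) - w (s n i)) ^ 2 ≤ M →
      |∑ i ∈ Finset.range (N n), (δ * (A (s n i) * Real.exp (δ * w (s n i))) +
          δ * (A (s n (i + 1)) * Real.exp (δ * w (s n (i + 1))))) / 2 *
            (w (s n (i + 1)) - w (s n i)) -
        (A b * Real.exp (δ * w b) - A a * Real.exp (δ * w a) -
          ∫ r in a..b, A' r * Real.exp (δ * w r))| ≤ ε := by
  have hAc : ContinuousOn A (Icc a b) := fun x hx => (hA x hx).continuousAt.continuousWithinAt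
  have hEc : Continuous fun r => Real.exp (δ * w r) := by fun_prop
  obtain ⟨C₁, hC₁⟩ := isCompact_Icc.exists_bound_of_continuousOn hAc
  obtain ⟨C₂, hC₂⟩ := isCompact_Icc.exists_bound_of_continuousOn hA'
  obtain ⟨C₃, hC₃⟩ := isCompact_Icc.exists_bound_of_continuousOn (hEc.continuousOn (s := Icc a b))
  set C := max 0 (max C₁ (max C₂ C₃)) with hCdef
  have hC : 0 ≤ C := le_max_left _ _
  have hAC : ∀ s ∈ Icc a b, |A s| ≤ C := fun s hs =>
    (hC₁ s hs).trans ((le_max_left _ _).trans (le_max_right _ _))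
  have hA'C : ∀ s ∈ Icc a b, |A' s| ≤ C := fun s hs =>
    (hC₂ s hs).trans ((le_max_left _ _).trans ((le_max_right _ _).trans (le_max_right _ _)))
  have hEC : ∀ s ∈ Icc a b, Real.exp (δ * w s) ≤ C := fun s hs =>
    (le_abs_self _).trans ((hC₃ s hs).trans
      ((le_max_right _ _).trans ((le_max_right _ _).trans (le_max_right _ _))))
  set D := C * C * δ ^ 2 * M + (C * C + C) * (b - a) with hD
  have hD0 : 0 ≤ D := by
    have := sub_nonneg.2 hab
    positivity
  -- The cap `1` is what the cubic estimate requires; `D + 1` avoids division by zero.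
  set κ := min 1 (ε / (D + 1)) with hκ
  have hκ0 : 0 < κ := lt_min one_pos (by positivity)
  have hκD : D * κ ≤ ε := by
    calc D * κ ≤ D * (ε / (D + 1)) := by gcongr; exact min_le_right _ _
      _ = ε * (D / (D + 1)) := by ring
      _ ≤ ε * 1 := by gcongr; exact div_le_one_of_le₀ (by linarith) (by positivity)
      _ = ε := mul_one ε
  have huw := isCompact_Icc.uniformContinuousOn_of_continuous
    ((hw.const_mul δ).continuousOn (s := Icc a b))
  have huE := isCompact_Icc.uniformContinuousOn_of_continuous (hEc.continuousOn (s := Icc a b))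
  obtain ⟨η₁, hη₁, H₁⟩ := Metric.uniformContinuousOn_iff.1 huw κ hκ0
  obtain ⟨η₂, hη₂, H₂⟩ := Metric.uniformContinuousOn_iff.1 huE κ hκ0
  filter_upwards [hmesh (min η₁ η₂) (lt_min hη₁ hη₂)] with n hn hQ
  obtain ⟨hmono, hs0, hsN⟩ := hs n
  have hmem : ∀ i ≤ N n, s n i ∈ Icc a b := fun i hi =>
    ⟨hs0 ▸ hmono (Nat.zero_le i), hsN ▸ hmono hi⟩
  have htel : A b * Real.exp (δ * w b) - A a * Real.exp (δ * w a) =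
      ∑ i ∈ Finset.range (N n), (A (s n (i + 1)) * Real.exp (δ * w (s n (i + 1))) -
        A (s n i) * Real.exp (δ * w (s n i))) := by
    rw [Finset.sum_range_sub (fun i => A (s n i) * Real.exp (δ * w (s n i))), hs0, hsN]
  have hint : ∫ r in a..b, A' r * Real.exp (δ * w r) =
      ∑ i ∈ Finset.range (N n), ∫ r in s n i..s n (i + 1), A' r * Real.exp (δ * w r) := by
    rw [intervalIntegral.sum_integral_adjacent_intervals, hs0, hsN]
    intro i hi
    refine ContinuousOn.intervalIntegrable ((hA'.mono ?_).mul (by fun_prop))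
    rw [uIcc_of_le (hmono i.le_succ)]
    exact Icc_subset_Icc (hmem i hi.le).1 (hmem (i + 1) hi).2
  have hstep : ∀ i ∈ Finset.range (N n), _ := fun i hi => by
    have hi' := Finset.mem_range.1 hi
    have hgap : s n (i + 1) - s n i < min η₁ η₂ := hn i hi'
    have hle : s n i ≤ s n (i + 1) := hmono i.le_succ
    refine abs_trapezoid_step_le (δ := δ) (κ := κ) hw hA hA' hC hAC hA'C hEC (hmem i hi'.le)
      (hmem (i + 1) hi') hle (min_le_left _ _) ?_ ?_
    · refine (H₁ _ (hmem (i + 1) hi') _ (hmem i hi'.le) ?_).le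
      rw [Real.dist_eq, abs_of_nonneg (sub_nonneg.2 hle)]
      exact hgap.trans_le (min_le_left _ _)
    · intro r hr
      refine (H₂ _ ⟨(hmem i hi'.le).1.trans hr.1, hr.2.trans (hmem (i + 1) hi').2⟩ _
        (hmem (i + 1) hi') ?_).le
      rw [dist_comm, Real.dist_eq, abs_of_nonneg (sub_nonneg.2 hr.2)]
      have := hr.1
      exact lt_of_le_of_lt (by linarith) (hgap.trans_le (min_le_right _ _))
  have hlen : ∑ i ∈ Finset.range (N n), (s n (i + 1) - s n i) = b - a := by
    rw [Finset.sum_range_sub (s n), hs0, hsN]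
  rw [htel, hint, ← Finset.sum_sub_distrib, ← Finset.sum_sub_distrib]
  refine (Finset.abs_sum_le_sum_abs _ _).trans ?_
  calc _ ≤ ∑ i ∈ Finset.range (N n), (C * C * δ ^ 2 * κ * (w (s n (i + 1)) - w (s n i)) ^ 2 +
        (C * C + C) * κ * (s n (i + 1) - s n i)) := by
        refine Finset.sum_le_sum fun i hi => ?_
        rw [← sub_add]
        exact hstep i hi
    _ = C * C * δ ^ 2 * κ * ∑ i ∈ Finset.range (N n), (w (s n (i + 1)) - w (s n i)) ^ 2 +
        (C * C + C) * κ * (b - a) := by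
        rw [Finset.sum_add_distrib, ← Finset.mul_sum, ← Finset.mul_sum, hlen]
    _ ≤ C * C * δ ^ 2 * κ * M + (C * C + C) * κ * (b - a) := by gcongr
    _ = D * κ := by rw [hD]; ring
    _ ≤ ε := hκD

end Trapezoid

/-! ## Convergence in measure by localization -/

/-- Truncating to `Q n ≤ M` gives almost everywhere convergence, hence convergence in measure since
`μ` is finite. The discarded event has measure at most `C / M`, uniformly in `n`. -/
theorem tendstoInMeasure_of_localized {Ω : Type*} [MeasurableSpace Ω] {μ : Measure Ω}
    [IsFiniteMeasure μ] {f Q : ℕ → Ω → ℝ} {g : Ω → ℝ}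
    (hf : ∀ n, AEStronglyMeasurable (fun ω => f n ω - g ω) μ) (hQm : ∀ n, Measurable (Q n)) {C : ℝ}
    (hQ : ∀ n, ∀ M > 0, μ {ω | M ≤ Q n ω} ≤ ENNReal.ofReal (C / M))
    (hloc : ∀ᵐ ω ∂μ, ∀ M ≥ 0, ∀ ε > 0, ∀ᶠ n in atTop, Q n ω ≤ M → |f n ω - g ω| ≤ ε) :
    TendstoInMeasure μ f atTop g := by
  rw [tendstoInMeasure_iff_norm]
  intro ε hε
  rw [ENNReal.tendsto_nhds_zero]
  intro e he
  have hCM : Tendsto (fun M : ℝ => ENNReal.ofReal (C / M)) atTop (𝓝 0) := by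
    have h := (ENNReal.continuous_ofReal.tendsto 0).comp
      (tendsto_const_nhds.div_atTop tendsto_id : Tendsto (fun M : ℝ => C / M) atTop (𝓝 0))
    simpa [Function.comp_def] using h
  obtain ⟨M, hM, hM0⟩ := ((ENNReal.tendsto_nhds_zero.1 hCM (e / 2) (ENNReal.half_pos he.ne')).and
    (eventually_gt_atTop 0)).exists
  have hg : TendstoInMeasure μ
      (fun n => {ω | Q n ω ≤ M}.indicator fun ω => f n ω - g ω) atTop (fun _ => 0) := by
    refine tendstoInMeasure_of_tendsto_ae
      (fun n => (hf n).indicator (measurableSet_le (hQm n) measurable_const)) ?_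
    filter_upwards [hloc] with ω hω
    rw [Metric.tendsto_nhds]
    intro r hr
    filter_upwards [hω M hM0.le (r / 2) (half_pos hr)] with n hn
    rw [Real.dist_0_eq_abs]
    by_cases hQn : Q n ω ≤ M
    · rw [indicator_of_mem (show ω ∈ {ω | Q n ω ≤ M} from hQn)]
      exact (hn hQn).trans_lt (half_lt_self hr)
    · rw [indicator_of_notMem (show ω ∉ {ω | Q n ω ≤ M} from hQn), abs_zero]
      exact hr
  filter_upwards [ENNReal.tendsto_nhds_zero.1 ((tendstoInMeasure_iff_norm.1 hg) ε hε) (e / 2)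
    (ENNReal.half_pos he.ne')] with n hn
  calc μ {ω | ε ≤ ‖f n ω - g ω‖}
      ≤ μ ({ω | M ≤ Q n ω} ∪
          {ω | ε ≤ ‖{ω | Q n ω ≤ M}.indicator (fun ω => f n ω - g ω) ω - 0‖}) := by
        refine measure_mono fun ω hω => ?_
        by_cases hQn : Q n ω ≤ M
        · right
          show ε ≤ ‖{ω | Q n ω ≤ M}.indicator (fun ω => f n ω - g ω) ω - 0‖
          rw [indicator_of_mem (show ω ∈ {ω | Q n ω ≤ M} from hQn), sub_zero]
          exact hω
        · left; exact (not_le.1 hQn).le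
    _ ≤ e / 2 + e / 2 := (measure_union_le _ _).trans
        (add_le_add ((hQ n M hM0).trans hM) hn)
    _ = e := ENNReal.add_halves e

/-! ### Sums of squared increments under Wiener measure -/

namespace IsWienerMeasure

variable {P : Measure WienerPath}

theorem lintegral_sub_sq (hP : IsWienerMeasure P) {s t : ℝ} (hst : s ≤ t) :
    ∫⁻ ω, ENNReal.ofReal ((ω t - ω s) ^ 2) ∂P = ENNReal.ofReal (t - s) := by
  have := hP.isProbabilityMeasure
  have hlaw := hP.hasLaw_sub s t hst
  have h2 := hlaw.hasGaussianLaw.memLp_two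
  rw [← ofReal_integral_eq_lintegral_ofReal h2.integrable_sq
    (Eventually.of_forall fun _ => sq_nonneg _)]
  have hv := hlaw.variance_eq
  rw [variance_id_gaussianReal, variance_of_integral_eq_zero hlaw.aemeasurable
    (by rw [hlaw.integral_eq, integral_id_gaussianReal])] at hv
  rw [hv, Real.coe_toNNReal _ (sub_nonneg.2 hst)]

/-- Markov's inequality: the expected squares telescope to the length of the interval, whatever the
partition. -/
theorem measure_le_sum_sub_sq (hP : IsWienerMeasure P) {s : ℕ → ℝ} (hs : Monotone s) (N : ℕ)
    {M : ℝ} (hM : 0 < M) :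
    P {ω | M ≤ ∑ i ∈ Finset.range N, (ω (s (i + 1)) - ω (s i)) ^ 2} ≤
      ENNReal.ofReal ((s N - s 0) / M) := by
  have hm : ∀ i, Measurable fun ω : WienerPath => ENNReal.ofReal ((ω (s (i + 1)) - ω (s i)) ^ 2) :=
    fun i => (((Transcritical.measurable_eval _).sub
      (Transcritical.measurable_eval _)).pow_const 2).ennreal_ofReal
  have hint : ∫⁻ ω, ENNReal.ofReal (∑ i ∈ Finset.range N, (ω (s (i + 1)) - ω (s i)) ^ 2) ∂P =
      ENNReal.ofReal (s N - s 0) := by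
    simp only [ENNReal.ofReal_sum_of_nonneg fun i _ => sq_nonneg _]
    rw [lintegral_finsetSum _ fun i _ => hm i,
      Finset.sum_congr rfl fun i _ => hP.lintegral_sub_sq (hs i.le_succ),
      ← ENNReal.ofReal_sum_of_nonneg fun i _ => sub_nonneg.2 (hs i.le_succ),
      Finset.sum_range_sub s]
  rw [ENNReal.ofReal_div_of_pos hM, ← hint]
  refine le_trans (measure_mono fun ω hω => ?_) (meas_ge_le_lintegral_div
    (Measurable.aemeasurable ?_) (by simpa using hM) ENNReal.ofReal_ne_top)
  · exact ENNReal.ofReal_le_ofReal hω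
  · simp only [ENNReal.ofReal_sum_of_nonneg fun i _ => sq_nonneg _]
    exact Finset.measurable_fun_sum _ fun i _ => hm i

end IsWienerMeasure

/-! ## The solution formula -/

theorem measurable_intervalIntegral_of_continuous {α : Type*} {m : MeasurableSpace α}
    {u : ℝ → α → ℝ} (hu : ∀ x, Continuous fun r => u r x) (hm : ∀ r, Measurable (u r)) (a b : ℝ) :
    Measurable fun x => ∫ r in a..b, u r x := by
  have h : Measurable (Function.uncurry u) := measurable_uncurry_of_continuous_of_measurable hu hm
  have h' : StronglyMeasurable fun p : α × ℝ => u p.2 p.1 :=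
    (h.comp measurable_swap).stronglyMeasurable
  exact ((h'.integral_prod_right' (ν := volume.restrict (Ioc a b))).sub
    (h'.integral_prod_right' (ν := volume.restrict (Ioc b a)))).measurable

namespace Transcritical

variable (lam δ : ℝ) (β : ℝ → ℝ) (τ x₀ : ℝ)

/-- The integrating factor of the linear part. -/
noncomputable def growth (ω : WienerPath) (t : ℝ) : ℝ := Real.exp (lam * (t - τ) + δ * (ω t - ω τ))

/-- The denominator of the solution formula relative to the linear flow. -/
noncomputable def relDenom (ω : WienerPath) (t : ℝ) : ℝ := 1 + x₀ * ∫ r in τ..t, growth lam δ τ ω r * β r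

/-- The solution divided by `exp (δ ω)`. -/
noncomputable def amplitude (ω : WienerPath) (t : ℝ) : ℝ :=
  x₀ * Real.exp (lam * (t - τ) - δ * ω τ) / relDenom lam δ β τ x₀ ω t

variable {lam δ β τ x₀}

theorem growth_pos (ω : WienerPath) (t : ℝ) : 0 < growth lam δ τ ω t := Real.exp_pos _

theorem continuous_growth (ω : WienerPath) : Continuous (growth lam δ τ ω) := by
  have := ω.continuous
  unfold growth
  fun_prop

theorem denom_eq (ω : WienerPath) (t : ℝ) :
    denom lam δ β t τ ω x₀ = relDenom lam δ β τ x₀ ω t / growth lam δ τ ω t := by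
  have h : ∀ r, Real.exp (lam * (r - t) + δ * (ω r - ω t)) * β r =
      (growth lam δ τ ω t)⁻¹ * (growth lam δ τ ω r * β r) := fun r => by
    rw [growth, growth, ← Real.exp_neg, ← mul_assoc, ← Real.exp_add]
    congr 2
    ring
  have h2 : Real.exp (lam * (τ - t) + δ * (ω τ - ω t)) = (growth lam δ τ ω t)⁻¹ := by
    rw [growth, ← Real.exp_neg]
    congr 1
    ring
  rw [denom, relDenom, h2]
  simp only [h]
  rw [intervalIntegral.integral_const_mul]
  field_simp

theorem mem_alive_iff {ω : WienerPath} {t : ℝ} :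
    ω ∈ alive lam δ β τ x₀ t ↔ 0 < relDenom lam δ β τ x₀ ω t := by
  rw [alive, mem_ofPred_eq, denom_eq, div_pos_iff_of_pos_right (growth_pos ω t)]

theorem sol_eq (ω : WienerPath) (t : ℝ) :
    sol lam δ β t τ ω x₀ = x₀ * growth lam δ τ ω t / relDenom lam δ β τ x₀ ω t := by
  rw [sol, denom_eq, div_div_eq_mul_div]

/-- All roughness in `t` goes into the exponential; the first factor depends on the path only
through `ω τ` and an integral, so it is differentiable where `relDenom` does not vanish. -/
theorem sol_eq_amplitude_mul (ω : WienerPath) (t : ℝ) :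
    sol lam δ β t τ ω x₀ = amplitude lam δ β τ x₀ ω t * Real.exp (δ * ω t) := by
  rw [sol_eq, amplitude, div_mul_eq_mul_div, mul_assoc x₀, ← Real.exp_add, growth]
  congr 3
  ring

theorem relDenom_initial (ω : WienerPath) : relDenom lam δ β τ x₀ ω τ = 1 := by
  simp [relDenom]

theorem sol_initial (ω : WienerPath) : sol lam δ β τ τ ω x₀ = x₀ := by
  simp [sol_eq, relDenom_initial, growth]

theorem hasDerivAt_relDenom (hβ : Continuous β) (ω : WienerPath) (t : ℝ) :
    HasDerivAt (relDenom lam δ β τ x₀ ω) (x₀ * (growth lam δ τ ω t * β t)) t := by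
  have hc : Continuous fun r => growth lam δ τ ω r * β r := (continuous_growth ω).mul hβ
  exact ((intervalIntegral.integral_hasDerivAt_right (hc.intervalIntegrable _ _)
    (hc.stronglyMeasurableAtFilter _ _) hc.continuousAt).const_mul x₀).const_add 1

theorem continuous_relDenom (hβ : Continuous β) (ω : WienerPath) :
    Continuous (relDenom lam δ β τ x₀ ω) :=
  continuous_iff_continuousAt.2 fun t => (hasDerivAt_relDenom hβ ω t).continuousAt

/-- For `x₀ ≥ 0` the denominator never drops below `1`; for `x₀ ≤ 0` it is nonincreasing in time.
Either way, survival up to `t` means survival throughout `[τ, t]`. -/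
theorem relDenom_pos_of_le (hβc : Continuous β) (hβ : ∀ t, 0 ≤ β t) {ω : WienerPath} {s t : ℝ}
    (hτs : τ ≤ s) (hst : s ≤ t) (h : 0 < relDenom lam δ β τ x₀ ω t) :
    0 < relDenom lam δ β τ x₀ ω s := by
  have hg : ∀ r, 0 ≤ growth lam δ τ ω r * β r := fun r => mul_nonneg (growth_pos ω r).le (hβ r)
  have hc : Continuous fun r => growth lam δ τ ω r * β r := (continuous_growth ω).mul hβc
  rcases le_total 0 x₀ with hx | hx
  · have := intervalIntegral.integral_nonneg (μ := volume) hτs fun r _ => hg r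
    unfold relDenom
    positivity
  · refine h.trans_le (add_le_add_right (mul_le_mul_of_nonpos_left ?_ hx) 1)
    rw [← intervalIntegral.integral_add_adjacent_intervals (hc.intervalIntegrable τ s)
      (hc.intervalIntegrable s t)]
    exact le_add_of_nonneg_right (intervalIntegral.integral_nonneg hst fun r _ => hg r)

theorem continuousAt_sol (hβ : Continuous β) {ω : WienerPath} {t : ℝ}
    (h : relDenom lam δ β τ x₀ ω t ≠ 0) :
    ContinuousAt (fun s => sol lam δ β s τ ω x₀) t := by
  simp only [sol_eq]
  exact ((continuous_growth ω).const_mul x₀).continuousAt.div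
    (continuous_relDenom hβ ω).continuousAt h

theorem hasDerivAt_amplitude (hβ : Continuous β) {ω : WienerPath} {t : ℝ}
    (h : relDenom lam δ β τ x₀ ω t ≠ 0) :
    HasDerivAt (amplitude lam δ β τ x₀ ω)
      (amplitude lam δ β τ x₀ ω t * (lam - β t * sol lam δ β t τ ω x₀)) t := by
  have h1 : HasDerivAt (fun s => x₀ * Real.exp (lam * (s - τ) - δ * ω τ))
      (x₀ * (Real.exp (lam * (t - τ) - δ * ω τ) * lam)) t := by
    have : HasDerivAt (fun s => lam * (s - τ) - δ * ω τ) lam t := by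
      simpa using (((hasDerivAt_id t).sub_const τ).const_mul lam).sub_const (δ * ω τ)
    exact this.exp.const_mul x₀
  refine HasDerivAt.congr_deriv (f := amplitude lam δ β τ x₀ ω)
    (h1.div (hasDerivAt_relDenom hβ ω t) h) ?_
  rw [amplitude, sol_eq]
  field_simp

/-- At the first dead time continuity forces the denominator to vanish, approached through positive
values, while the numerator keeps a nonzero limit. -/
theorem tendsto_abs_sol_atTop (hβc : Continuous β) {ω : WienerPath} {t : ℝ}
    (ht : τ < t) (halive : ∀ s, τ ≤ s → s < t → 0 < relDenom lam δ β τ x₀ ω s)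
    (hdead : ¬ 0 < relDenom lam δ β τ x₀ ω t) :
    Tendsto (fun s => |sol lam δ β s τ ω x₀|) (𝓝[<] t) atTop := by
  have hx : x₀ ≠ 0 := by
    rintro rfl
    exact hdead (by simp [relDenom])
  have hev : ∀ᶠ s in 𝓝[<] t, 0 < relDenom lam δ β τ x₀ ω s := by
    filter_upwards [Ioo_mem_nhdsLT ht] with s hs using halive s hs.1.le hs.2
  have hlim : Tendsto (relDenom lam δ β τ x₀ ω) (𝓝[<] t) (𝓝 (relDenom lam δ β τ x₀ ω t)) :=
    ((continuous_relDenom hβc ω).tendsto t).mono_left nhdsWithin_le_nhds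
  have h0 : relDenom lam δ β τ x₀ ω t = 0 :=
    le_antisymm (not_lt.1 hdead) (ge_of_tendsto hlim (hev.mono fun _ h => h.le))
  rw [h0] at hlim
  have hlim' : Tendsto (relDenom lam δ β τ x₀ ω) (𝓝[<] t) (𝓝[>] 0) :=
    tendsto_nhdsWithin_iff.2 ⟨hlim, hev⟩
  have hnum : Tendsto (fun s => |x₀ * growth lam δ τ ω s|) (𝓝[<] t)
      (𝓝 |x₀ * growth lam δ τ ω t|) :=
    (((continuous_growth ω).const_mul x₀).abs.tendsto t).mono_left nhdsWithin_le_nhds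
  have hpos : 0 < |x₀ * growth lam δ τ ω t| := abs_pos.2 (mul_ne_zero hx (growth_pos ω t).ne')
  refine (hnum.pos_mul_atTop hpos (tendsto_inv_nhdsGT_zero.comp hlim')).congr' ?_
  filter_upwards [hev] with s hs
  rw [sol_eq, abs_div, abs_of_pos hs, div_eq_mul_inv, Function.comp_apply]

/-! ### Measurability -/

theorem measurable_increment {t r : ℝ} (hr : r ∈ Icc τ t) :
    Measurable[incrementSigma τ t] fun ω : WienerPath => ω r - ω τ :=
  (comap_measurable (fun ω : WienerPath => ω r - ω τ)).mono (le_iSup₂_of_le r hr le_rfl) le_rfl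

theorem measurable_growth_increment {t r : ℝ} (hr : r ∈ Icc τ t) :
    Measurable[incrementSigma τ t] fun ω : WienerPath => growth lam δ τ ω r := by
  have h : Measurable fun x : ℝ => Real.exp (lam * (r - τ) + δ * x) := by fun_prop
  exact h.comp (measurable_increment hr)

theorem measurable_relDenom_increment (hβ : Continuous β) {t : ℝ} (ht : τ ≤ t) :
    Measurable[incrementSigma τ t] fun ω => relDenom lam δ β τ x₀ ω t := by
  -- Clamping the time to `[τ, t]` makes the integrand measurable for the increment σ-algebra at
  -- every real `r`, without changing the integral.
  have h := @measurable_intervalIntegral_of_continuous WienerPath (incrementSigma τ t)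
    (fun r ω => growth lam δ τ ω (projIcc τ t ht r) * β r)
    (fun ω => ((continuous_growth ω).comp
      (continuous_subtype_val.comp continuous_projIcc)).mul hβ)
    (fun r => (measurable_growth_increment (projIcc τ t ht r).2).mul_const (β r)) τ t
  have h2 : (fun ω => relDenom lam δ β τ x₀ ω t) = fun ω =>
      1 + x₀ * ∫ r in τ..t, growth lam δ τ ω (projIcc τ t ht r) * β r := by
    funext ω
    rw [relDenom]
    congr 2
    refine intervalIntegral.integral_congr fun r hr => ?_
    rw [uIcc_of_le ht] at hr
    simp only [projIcc_of_mem ht hr]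
  rw [h2]
  exact (h.const_mul x₀).const_add 1

theorem measurable_sol_increment (hβ : Continuous β) {t : ℝ} (ht : τ ≤ t) :
    Measurable[incrementSigma τ t] fun ω => sol lam δ β t τ ω x₀ := by
  simp only [sol_eq]
  exact ((measurable_growth_increment (right_mem_Icc.2 ht)).const_mul x₀).div
    (measurable_relDenom_increment hβ ht)

theorem measurable_growth (t : ℝ) : Measurable fun ω : WienerPath => growth lam δ τ ω t := by
  have h1 := measurable_eval t
  have h2 := measurable_eval τ
  unfold growth
  fun_prop

theorem measurable_relDenom (hβ : Continuous β) (t : ℝ) :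
    Measurable fun ω => relDenom lam δ β τ x₀ ω t :=
  ((measurable_intervalIntegral_of_continuous (u := fun r ω => growth lam δ τ ω r * β r)
    (fun ω => (continuous_growth ω).mul hβ) (fun r => (measurable_growth r).mul_const _)
    τ t).const_mul x₀).const_add 1

theorem measurable_uncurry_sol (hβ : Continuous β) :
    Measurable fun p : ℝ × WienerPath => sol lam δ β p.1 τ p.2 x₀ := by
  simp only [sol_eq]
  have h1 := measurable_uncurry_of_continuous_of_measurable
    (u := fun t (ω : WienerPath) => growth lam δ τ ω t) continuous_growth measurable_growth
  have h2 := measurable_uncurry_of_continuous_of_measurable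
    (u := fun t (ω : WienerPath) => relDenom lam δ β τ x₀ ω t) (continuous_relDenom hβ)
    (measurable_relDenom hβ)
  exact (h1.const_mul x₀).div h2

theorem measurable_sol (hβ : Continuous β) (t : ℝ) :
    Measurable fun ω => sol lam δ β t τ ω x₀ :=
  (measurable_uncurry_sol hβ).comp (measurable_const.prodMk measurable_id)

theorem measurable_integral_drift (hβ : Continuous β) (t : ℝ) :
    Measurable fun ω => ∫ s in τ..t,
      (lam * sol lam δ β s τ ω x₀ - β s * sol lam δ β s τ ω x₀ ^ 2) := by
  have h := measurable_uncurry_sol (lam := lam) (δ := δ) (τ := τ) (x₀ := x₀) hβ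
  have h1 : Measurable fun p : WienerPath × ℝ => sol lam δ β p.2 τ p.1 x₀ := h.comp measurable_swap
  have h2 : StronglyMeasurable fun p : WienerPath × ℝ =>
      lam * sol lam δ β p.2 τ p.1 x₀ - β p.2 * sol lam δ β p.2 τ p.1 x₀ ^ 2 :=
    ((h1.const_mul lam).sub ((hβ.measurable.comp measurable_snd).mul
      (h1.pow_const 2))).stronglyMeasurable
  exact ((h2.integral_prod_right' (ν := volume.restrict (Ioc τ t))).sub
    (h2.integral_prod_right' (ν := volume.restrict (Ioc t τ)))).measurable

/-! ### The Stratonovich equation -/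

theorem isStratonovichIntegral_sol {P : Measure WienerPath} (hP : IsWienerMeasure P)
    (hβc : Continuous β) (hβ : ∀ t, 0 ≤ β t) {t : ℝ} (ht : τ ≤ t) :
    IsStratonovichIntegral (P.restrict (alive lam δ β τ x₀ t))
      (fun s ω => δ * sol lam δ β s τ ω x₀) (fun s ω => ω s) τ t
      (fun ω => sol lam δ β t τ ω x₀ - x₀ -
        ∫ s in τ..t, (lam * sol lam δ β s τ ω x₀ - β s * sol lam δ β s τ ω x₀ ^ 2)) := by
  intro N s hs hmesh
  have := hP.isProbabilityMeasure
  have halive : MeasurableSet (alive lam δ β τ x₀ t) := by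
    simp only [Set.ext fun ω => mem_alive_iff (ω := ω) (t := t)]
    exact measurableSet_lt measurable_const (measurable_relDenom hβc t)
  refine tendstoInMeasure_of_localized (C := t - τ)
    (Q := fun n ω => ∑ i ∈ Finset.range (N n), (ω (s n (i + 1)) - ω (s n i)) ^ 2)
    (fun n => ?_) (fun n => ?_) (fun n M hM => ?_) ?_
  · refine Measurable.aestronglyMeasurable (Measurable.sub ?_ ?_)
    · exact Finset.measurable_fun_sum _ fun i _ =>
        ((((measurable_sol hβc _).const_mul δ).add ((measurable_sol hβc _).const_mul δ)).div_const
          2).mul ((measurable_eval _).sub (measurable_eval _))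
    · exact ((measurable_sol hβc t).sub_const x₀).sub (measurable_integral_drift hβc t)
  · exact Finset.measurable_fun_sum _ fun i _ =>
      ((measurable_eval _).sub (measurable_eval _)).pow_const 2
  · have h := hP.measure_le_sum_sub_sq (hs n).1 (N n) hM
    rw [(hs n).2.1, (hs n).2.2] at h
    exact (Measure.restrict_apply_le _ _).trans h
  · refine (ae_restrict_iff' halive).2 (Eventually.of_forall fun ω hω M hM ε hε => ?_)
    have hpos : ∀ r ∈ Icc τ t, relDenom lam δ β τ x₀ ω r ≠ 0 := fun r hr =>
      (relDenom_pos_of_le hβc hβ hr.1 hr.2 (mem_alive_iff.1 hω)).ne'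
    have hA : ∀ r ∈ Icc τ t, HasDerivAt (amplitude lam δ β τ x₀ ω)
        (amplitude lam δ β τ x₀ ω r * (lam - β r * sol lam δ β r τ ω x₀)) r := fun r hr =>
      hasDerivAt_amplitude hβc (hpos r hr)
    have hA' : ContinuousOn (fun r => amplitude lam δ β τ x₀ ω r *
        (lam - β r * sol lam δ β r τ ω x₀)) (Icc τ t) := fun r hr =>
      ((hA r hr).continuousAt.mul (continuousAt_const.sub
        (hβc.continuousAt.mul (continuousAt_sol hβc (hpos r hr))))).continuousWithinAt
    have key := eventually_abs_trapezoid_sum_le (δ := δ) ht ω.continuous hA hA' hs hmesh hε hM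
    simp only [← sol_eq_amplitude_mul, sol_initial] at key
    have hdrift : ∀ r, amplitude lam δ β τ x₀ ω r * (lam - β r * sol lam δ β r τ ω x₀) *
        Real.exp (δ * ω r) = lam * sol lam δ β r τ ω x₀ - β r * sol lam δ β r τ ω x₀ ^ 2 := by
      intro r
      rw [mul_right_comm, ← sol_eq_amplitude_mul]
      ring
    simp only [hdrift] at key
    exact key

theorem isMaximalStratonovichSolution_sol {P : Measure WienerPath} (hP : IsWienerMeasure P)
    (hβc : Continuous β) (hβ : ∀ t, 0 ≤ β t) :
    IsMaximalStratonovichSolution P (fun t x => lam * x - β t * x ^ 2) (fun _ x => δ * x) τ x₀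
      (alive lam δ β τ x₀) (fun t ω => sol lam δ β t τ ω x₀) where
  alive_initial := eq_univ_of_forall fun ω =>
    mem_alive_iff.2 (by rw [relDenom_initial]; exact one_pos)
  alive_antitone s t hs hst ω hω :=
    mem_alive_iff.2 (relDenom_pos_of_le hβc hβ hs hst (mem_alive_iff.1 hω))
  alive_open t _ ω hω := by
    have h := (((continuous_relDenom hβc ω).tendsto t).eventually
      (lt_mem_nhds (mem_alive_iff.1 hω))).filter_mono (nhdsWithin_le_nhds (s := Ioi t))
    obtain ⟨t', ht', h'⟩ := (h.and self_mem_nhdsWithin).exists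
    exact ⟨t', h', mem_alive_iff.2 ht'⟩
  explosion ω t ht h hdead := tendsto_abs_sol_atTop hβc ht
    (fun s hs hst => mem_alive_iff.1 (h s hs hst)) fun hpos => hdead (mem_alive_iff.2 hpos)
  initial := sol_initial
  continuousOn t _ ω hω s hs := (continuousAt_sol hβc
    (relDenom_pos_of_le hβc hβ hs.1 hs.2 (mem_alive_iff.1 hω)).ne').continuousWithinAt
  adapted_alive t ht := by
    have h : alive lam δ β τ x₀ t = (fun ω => relDenom lam δ β τ x₀ ω t) ⁻¹' Ioi 0 :=
      Set.ext fun ω => mem_alive_iff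
    rw [h]
    exact measurable_relDenom_increment hβc ht measurableSet_Ioi
  adapted t ht := measurable_sol_increment hβc ht
  equation t ht := isStratonovichIntegral_sol hP hβc hβ ht

end Transcritical

/-! ### The bifurcation theorem -/

theorem corollary4p2 (P : Measure WienerPath) (hP : IsWienerMeasure P)
    (β : ℝ → ℝ) (hβ : ContDiff ℝ ((⊤ : ℕ∞) : WithTop ℕ∞) β) (β₀ β₁ : ℝ) (hβ₀ : 0 < β₀)
    (hbound : ∀ t, β₀ ≤ β t ∧ β t ≤ β₁) (δ : ℝ) (hδ : 0 < δ)
    (k : Recurrence) (hk : k.Holds β) :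
    -- almost every path is regular, and the solution formula solves the Stratonovich equation
    (∀ᵐ ω ∂P, IsRegularPath δ ω) ∧
    (∀ lam τ x₀ : ℝ, IsMaximalStratonovichSolution P
      (fun t x => lam * x - β t * x ^ 2) (fun _ x => δ * x) τ x₀
      (Transcritical.alive lam δ β τ x₀)
      (fun t ω => Transcritical.sol lam δ β t τ ω x₀)) ∧
    -- negative parameter
    (∀ lam < 0,
      IsRandomRecurrentSolution k RegularPath.shift (Transcritical.cocycle lam δ β)
        (fun _ _ => 0) ∧
      IsRandomRecurrentSolution k RegularPath.shift (Transcritical.cocycle lam δ β)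
        (Transcritical.xBif lam δ β) ∧
      IsPullbackAsymptoticallyStable RegularPath.shift (Transcritical.cocycle lam δ β)
        0 (Ioi 0) ∧
      (∀ K : Set ℝ, IsCompact K → K ⊆ Ioi 0 →
        PullbackAttracts RegularPath.shift (Transcritical.cocycle lam δ β) (fun _ _ => 0) K) ∧
      (∀ τ ω, Transcritical.xBif lam δ β τ ω < 0)) ∧
    (∀ τ (ω : RegularPath δ),
      Tendsto (fun lam => Transcritical.xBif lam δ β τ ω) (𝓝[<] 0) (𝓝 0)) ∧
    -- positive parameter
    (∀ lam > 0,
      IsRandomRecurrentSolution k RegularPath.shift (Transcritical.cocycle lam δ β)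
        (fun _ _ => 0) ∧
      IsRandomRecurrentSolution k RegularPath.shift (Transcritical.cocycle lam δ β)
        (Transcritical.xBif lam δ β) ∧
      IsPullbackUnstable RegularPath.shift (Transcritical.cocycle lam δ β) 0 (Ioi 0) ∧
      (∀ K : Set ℝ, IsCompact K → K ⊆ Ioi 0 →
        PullbackAttracts RegularPath.shift (Transcritical.cocycle lam δ β)
          (Transcritical.xBif lam δ β) K) ∧
      (∀ τ ω, 0 < Transcritical.xBif lam δ β τ ω)) ∧
    (∀ τ (ω : RegularPath δ),
      Tendsto (fun lam => Transcritical.xBif lam δ β τ ω) (𝓝[>] 0) (𝓝 0)) := by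
  have hβc : Continuous β := hβ.continuous
  have hβ0 : ∀ t, 0 ≤ β t := fun t => hβ₀.le.trans (hbound t).1
  have hreg := hP.ae_isRegularPath hδ.le
  have := hP.isProbabilityMeasure
  -- Instability asserts that some orbit escapes, so it needs at least one regular path; full
  -- measure supplies it.
  have : Nonempty (RegularPath δ) := hreg.exists.elim fun ω hω => ⟨⟨ω, hω⟩⟩
  exact ⟨hreg,
    fun _ _ _ => Transcritical.isMaximalStratonovichSolution_sol hP hβc hβ0,
    fun lam hlam => ⟨Transcritical.isRandomRecurrentSolution_zero k,
      Transcritical.isRandomRecurrentSolution_xBif_of_neg hk hβc hβ₀ hbound hlam,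
      Transcritical.isPullbackAsymptoticallyStable_zero hβ0 hlam,
      fun _ hK hK0 => Transcritical.pullbackAttracts_zero hβ0 hlam hK hK0,
      Transcritical.xBif_neg hβc hβ₀ hbound hlam⟩,
    Transcritical.tendsto_xBif_nhdsLT hβc hβ₀ hbound,
    fun lam hlam => ⟨Transcritical.isRandomRecurrentSolution_zero k,
      Transcritical.isRandomRecurrentSolution_xBif_of_pos hk hβc hβ₀ hbound hlam,
      Transcritical.isPullbackUnstable_zero hβc hβ₀ hbound hlam,
      fun _ hK hK0 => Transcritical.pullbackAttracts_xBif hβc hβ₀ hbound hlam hK hK0,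
      Transcritical.xBif_pos hβc hβ₀ hbound hlam⟩,
    Transcritical.tendsto_xBif_nhdsGT hβc hβ₀ hbound⟩
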